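/- Let $\mu$ be normalized Haar measure on $SU(2)$, and let $d(x,y)=\sqrt{\tfrac12\operatorname{tr}\big((x-y)(x-y)^*\big)}$ for $x,y\in SU(2)$. Let $e$ be the identity matrix. For integrable $f,g$ on $SU(2)$ put $(f*g)(x)=\int_{SU(2)}f(xy^{-1})g(y)\,d\mu(y)$. Call $f\in L^1(SU(2))$ *central* if $f*g=g*f$ in $L^1(SU(2))$ for every $g\in L^1(SU(2))$. For $n\ge 0$ let $\chi_n$ be the character (trace) of the $(n+1)$-dimensional irreducible representation $\pi_n$ of $SU(2)$, realized on the complex homogeneous polynomials of degree $n$ in two variables by $(\pi_n(x)p)(z)=p(zx)$. Let $\mathbf D_N=\sum_{n=0}^N(n+1)\chi_n$, and let $S_Nf=f*\mathbf D_N$ be the $N$th Fourier partial sum of $f$. **Theorem.** Let $0<\alpha<1$ and let $f:SU(2)\to\mathbb R$ be a central function that is $\alpha$-Hölder continuous, that is, there is $M\ge 0$ with $|f(x)-f(y)|\le M\,d(x,y)^\alpha$ for all $x,y\in SU(2)$. Then: (a) for every open set $U\subseteq SU(2)$ containing both $e$ and $-e$, $S_Nf\to f$ uniformly on $SU(2)\setminus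 U$ as $N\to\infty$; (b) if both sequences $\{S_Nf(e)\}_{N=0}^\infty$ and $\{S_Nf(-e)\}_{N=0}^\infty$ converge, then $S_Nf\to f$ uniformly on $SU(2)$. -/

import Mathlib

open MeasureTheory Filter Topology

/-- The special unitary group `SU(2)`, with the group structure of Mathlib and the topology
inherited from the `2 × 2` complex matrices. -/
abbrev SU2 : Type := Matrix.specialUnitaryGroup (Fin 2) ℂ

namespace SU2

instance instContinuousInv : ContinuousInv SU2 where
  continuous_inv := by
    refine Continuous.subtype_mk (f := fun x : SU2 => star (x : Matrix (Fin 2) (Fin 2) ℂ)) ?_ _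
    exact continuous_star.comp continuous_subtype_val

instance instIsTopologicalGroup : IsTopologicalGroup SU2 where

instance instCompactSpace : CompactSpace SU2 := by
  refine isCompact_iff_compactSpace.mp ?_
  have hK : IsCompact (Set.pi Set.univ fun _ : Fin 2 => Set.pi Set.univ fun _ : Fin 2 =>
      Metric.closedBall (0 : ℂ) 1) :=
    isCompact_univ_pi fun _ => isCompact_univ_pi fun _ => isCompact_closedBall _ _
  have hclosed : IsClosed {A : Matrix (Fin 2) (Fin 2) ℂ | A * star A = 1 ∧ A.det = 1} := by
    refine IsClosed.inter ?_ ?_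
    · exact isClosed_eq (continuous_id.mul continuous_star) continuous_const
    · exact isClosed_eq (Continuous.matrix_det continuous_id) continuous_const
  have heq : (Matrix.specialUnitaryGroup (Fin 2) ℂ : Set (Matrix (Fin 2) (Fin 2) ℂ)) =
      {A : Matrix (Fin 2) (Fin 2) ℂ | A * star A = 1 ∧ A.det = 1} := by
    ext A
    simp [Matrix.mem_specialUnitaryGroup_iff, Matrix.mem_unitaryGroup_iff]
  rw [heq]
  refine IsCompact.of_isClosed_subset hK hclosed ?_
  rintro A ⟨hA, -⟩ i - j -
  simpa using entry_norm_bound_of_unitary (Matrix.mem_unitaryGroup_iff.mpr hA) i j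

/-- `SU(2)` carries its Borel σ-algebra. -/
noncomputable instance instMeasurableSpace : MeasurableSpace SU2 := borel SU2

instance instBorelSpace : BorelSpace SU2 := ⟨rfl⟩

/-- Normalized Haar measure on `SU(2)`: the Haar measure that gives the whole group mass `1`. -/
noncomputable def haar : Measure SU2 := Measure.haarMeasure ⊤

/-- The element `-e` of `SU(2)`. -/
noncomputable def negOne : SU2 :=
  ⟨-1, by simp [Matrix.mem_specialUnitaryGroup_iff, Matrix.mem_unitaryGroup_iff, Matrix.det_neg]⟩

/-- The bi-invariant distance `d(x, y) = √(½ tr ((x - y)(x - y)*))` on `SU(2)`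
(the trace is a non-negative real number). -/
noncomputable def distance (x y : SU2) : ℝ :=
  Real.sqrt (1 / 2 * (Matrix.trace
    ((x.val - y.val) * star (x.val - y.val))).re)

/-- `f ∈ Lip_α(SU(2))`: the real function `f` is `α`-Hölder continuous. -/
def IsHolder (α : ℝ) (f : SU2 → ℝ) : Prop :=
  ∃ M : ℝ, 0 ≤ M ∧ ∀ x y : SU2, |f x - f y| ≤ M * distance x y ^ α

/-- The convolution `(f ∗ g)(x) = ∫ f(x y⁻¹) g(y) dμ(y)`. -/
noncomputable def conv (f g : SU2 → ℂ) (x : SU2) : ℂ :=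
  ∫ y, f (x * y⁻¹) * g y ∂haar

/-- `f` is central: `f ∈ L¹(SU(2))` and `f ∗ g = g ∗ f` in `L¹(SU(2))` for all
`g ∈ L¹(SU(2))`. -/
def IsCentral (f : SU2 → ℂ) : Prop :=
  Integrable f haar ∧ ∀ g : SU2 → ℂ, Integrable g haar → conv f g =ᵐ[haar] conv g f

/-- The substitution `p(z) ↦ p(z x)` on polynomials in two variables, where `z = (z₀, z₁)` is
a row vector. -/
noncomputable def subst (x : SU2) : MvPolynomial (Fin 2) ℂ →ₐ[ℂ] MvPolynomial (Fin 2) ℂ :=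
  MvPolynomial.aeval fun j : Fin 2 =>
    ∑ i : Fin 2, MvPolynomial.C ((x : Matrix (Fin 2) (Fin 2) ℂ) i j) * MvPolynomial.X i

theorem subst_mem (n : ℕ) (x : SU2) (p : MvPolynomial (Fin 2) ℂ)
    (hp : p ∈ MvPolynomial.homogeneousSubmodule (Fin 2) ℂ n) :
    subst x p ∈ MvPolynomial.homogeneousSubmodule (Fin 2) ℂ n := by
  rw [MvPolynomial.mem_homogeneousSubmodule] at hp ⊢
  have h := hp.aeval (fun j : Fin 2 => ∑ i : Fin 2,
      MvPolynomial.C ((x : Matrix (Fin 2) (Fin 2) ℂ) i j) * MvPolynomial.X i) (n := 1)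
    (fun j => MvPolynomial.IsHomogeneous.sum _ _ _ fun i _ => by
      simpa using (MvPolynomial.isHomogeneous_C (Fin 2)
        ((x : Matrix (Fin 2) (Fin 2) ℂ) i j)).mul (MvPolynomial.isHomogeneous_X ℂ i))
  simpa [subst] using h

theorem subst_one : subst 1 = AlgHom.id ℂ _ := by
  refine MvPolynomial.algHom_ext fun j => ?_
  fin_cases j <;> simp [subst]

theorem subst_mul (x y : SU2) : subst (x * y) = (subst x).comp (subst y) := by
  refine MvPolynomial.algHom_ext fun j => ?_
  simp [subst, Matrix.mul_apply, Fin.sum_univ_two]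
  ring

/-- The irreducible representation `π_n` of `SU(2)`, of dimension `n + 1`: the action by linear
substitution `(π_n(x) p)(z) = p(z x)` on the complex homogeneous polynomials of degree `n` in two
variables. Up to equivalence, `π₀, π₁, π₂, …` are all the continuous irreducible unitary
representations of `SU(2)`. -/
noncomputable def irrep (n : ℕ) :
    Representation ℂ SU2 (MvPolynomial.homogeneousSubmodule (Fin 2) ℂ n) where
  toFun x := (subst x).toLinearMap.restrict (subst_mem n x)
  map_one' := by
    ext1 p
    apply Subtype.ext
    simp [subst_one]
  map_mul' x y := by
    ext1 p
    apply Subtype.ext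
    exact congrArg (fun φ => φ (p : MvPolynomial (Fin 2) ℂ)) (subst_mul x y)

/-- The character `χ_n(x) = trace π_n(x)`. -/
noncomputable def character (n : ℕ) (x : SU2) : ℂ :=
  LinearMap.trace ℂ _ (irrep n x)

/-- The Dirichlet kernel `D_N = ∑_{n=0}^N (n + 1) χ_n`. -/
noncomputable def dirichletKernel (N : ℕ) (x : SU2) : ℂ :=
  ∑ n ∈ Finset.range (N + 1), ((n : ℂ) + 1) * character n x

/-- The `N`-th Fourier partial sum `S_N f = f ∗ D_N`. -/
noncomputable def fourierSum (N : ℕ) (f : SU2 → ℂ) : SU2 → ℂ :=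
  conv f (dirichletKernel N)

end SU2

/-! A continuous central function is a class function, so it is determined by the restriction `F θ =
f (torus θ)` to the maximal torus, which is even, `2π`-periodic and `α`-Hölder. There `χ_n` is
`U_n(cos θ) = sin((n+1)θ) / sin θ`, and Weyl's formula turns the coefficient of `χ_n` into `(a n - a
(n+2)) / 2`, where `a` are the cosine coefficients of `F`.

Since `2 T_n = U_n - U_{n-2}`, summation by parts gives, with `t = cos θ`, `S_N f = s_N F - (a (N+1)
U_{N-1}(t) + a (N+2) U_N(t)) / 2`, where `s_N F` is the ordinary cosine partial sum
(`fourierSum_eq_cosPartialSum_sub`). By the Dini–Lipschitz test `s_N F → F` uniformly, so only the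
boundary term matters.

For (a), `|U_n| ≤ 1 / sin θ` is bounded away from `±e`, while `a n → 0`. For (b), `|U_{n-1}| ≤ n`
everywhere, so it is enough that `N a (N+1) → 0`. Convergence at `e` says that `N a (N+1) + (N+1) a
(N+2)` has a limit; as `∑ a n` converges, a Cesàro argument (`eq_zero_of_tendsto_mul_add_mul`)
forces that limit to be `0`. Convergence at `-e` gives the same for the difference, and the two
together isolate each term. -/

namespace SU2

/-! ### Coordinates on `SU(2)`, the maximal torus and diagonalization -/

/-- The matrix `!![a, b; -b̄, ā]` with `|a|² + |b|² = 1` as an element of `SU(2)`. -/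
noncomputable def ofPair (a b : ℂ) (h : Complex.normSq a + Complex.normSq b = 1) : SU2 :=
  ⟨!![a, b; -(starRingEnd ℂ) b, (starRingEnd ℂ) a], by
    have h' : a * (starRingEnd ℂ) a + b * (starRingEnd ℂ) b = 1 := by
      rw [Complex.mul_conj, Complex.mul_conj]; exact_mod_cast h
    rw [Matrix.mem_specialUnitaryGroup_iff, Matrix.mem_unitaryGroup_iff]
    constructor
    · ext i j
      fin_cases i <;> fin_cases j <;>
        simp [Matrix.mul_apply, Fin.sum_univ_two, Matrix.star_apply] <;>
        first
        | linear_combination h'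
        | ring
    · rw [Matrix.det_fin_two_of]; linear_combination h'⟩

theorem ofPair_val (a b : ℂ) (h) : (ofPair a b h).val =
    !![a, b; -(starRingEnd ℂ) b, (starRingEnd ℂ) a] := rfl

/-- Both `x*` and the adjugate of `x` invert `x`, because `det x = 1`; equating their entries gives
the second row. -/
theorem exists_eq_ofPair (x : SU2) : ∃ h, x = ofPair (x.val 0 0) (x.val 0 1) h := by
  have hx := Matrix.mem_specialUnitaryGroup_iff.mp x.2
  have hU : x.val * star x.val = 1 := Matrix.mem_unitaryGroup_iff.mp hx.1
  have hadj : star x.val = x.val.adjugate := by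
    have h2 : x.val.adjugate * x.val = 1 := by
      rw [Matrix.adjugate_mul, hx.2, one_smul]
    calc star x.val = (x.val.adjugate * x.val) * star x.val := by rw [h2, one_mul]
      _ = x.val.adjugate := by rw [mul_assoc, hU, mul_one]
  rw [Matrix.adjugate_fin_two] at hadj
  have h00 := congrFun (congrFun hadj 0) 0
  have h10 := congrFun (congrFun hadj 1) 0
  have hd := hx.2
  rw [Matrix.det_fin_two] at hd
  simp [Matrix.star_apply] at h00 h10
  have h : Complex.normSq (x.val 0 0) + Complex.normSq (x.val 0 1) = 1 := by
    have : ((Complex.normSq (x.val 0 0) + Complex.normSq (x.val 0 1) : ℝ) : ℂ) = 1 := by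
      push_cast
      rw [← Complex.mul_conj, ← Complex.mul_conj, h00, h10]
      linear_combination hd
    exact_mod_cast this
  refine ⟨h, Subtype.ext ?_⟩
  rw [ofPair_val]
  ext i j
  fin_cases i <;> fin_cases j <;> simp [h00, h10]

/-- The maximal torus of `SU(2)`. -/
noncomputable def torus (θ : ℝ) : SU2 :=
  ofPair (Complex.exp (θ * Complex.I)) 0 (by simp [Complex.normSq_eq_norm_sq, Complex.norm_exp_ofReal_mul_I])

theorem conj_exp_ofReal_mul_I (θ : ℝ) :
    (starRingEnd ℂ) (Complex.exp (θ * Complex.I)) = Complex.exp (-(θ * Complex.I)) := by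
  rw [← Complex.exp_conj]; simp

theorem torus_val (θ : ℝ) : (torus θ).val =
    !![Complex.exp (θ * Complex.I), 0; 0, Complex.exp (-(θ * Complex.I))] := by
  rw [torus, ofPair_val, conj_exp_ofReal_mul_I]; simp

/-- Half of the trace of an element of `SU(2)`, which is real. -/
noncomputable def halfTrace (x : SU2) : ℝ := (x.val 0 0).re

theorem continuous_entry (i j : Fin 2) : Continuous fun x : SU2 => x.val i j :=
  (continuous_subtype_val).matrix_elem i j

theorem continuous_halfTrace : Continuous halfTrace :=
  Complex.continuous_re.comp (continuous_entry 0 0)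

@[simp] theorem halfTrace_torus (θ : ℝ) : halfTrace (torus θ) = Real.cos θ := by
  simp [halfTrace, torus_val, Complex.exp_ofReal_mul_I_re]

theorem halfTrace_mem_Icc (x : SU2) : halfTrace x ∈ Set.Icc (-1 : ℝ) 1 := by
  obtain ⟨h, -⟩ := exists_eq_ofPair x
  rw [Complex.normSq_apply, Complex.normSq_apply] at h
  constructor <;> (unfold halfTrace; nlinarith [mul_self_nonneg (x.val 0 0).im,
    mul_self_nonneg (x.val 0 1).re, mul_self_nonneg (x.val 0 1).im])

@[fun_prop]
theorem continuous_torus : Continuous torus := by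
  refine Continuous.subtype_mk (f := fun θ => (torus θ).val) ?_ _
  simp only [torus_val]
  refine continuous_matrix fun i j => ?_
  fin_cases i <;> fin_cases j <;> simp <;> fun_prop

theorem torus_zero : torus 0 = 1 := by
  apply Subtype.ext
  rw [torus_val]
  simp [Matrix.one_fin_two]

theorem torus_pi : torus Real.pi = negOne := by
  apply Subtype.ext
  rw [torus_val]
  ext i j
  fin_cases i <;> fin_cases j <;> simp [negOne, Complex.exp_neg]

/-- The hypotheses are the first row of the matrix identity. The second row is their conjugate. -/
theorem ofPair_mul_eq {a b v w : ℂ} {h h'} {l : ℝ}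
    (h₁ : a * v - b * (starRingEnd ℂ) w = v * Complex.exp (l * Complex.I))
    (h₂ : a * w + b * (starRingEnd ℂ) v = w * Complex.exp (-(l * Complex.I))) :
    ofPair a b h * ofPair v w h' = ofPair v w h' * torus l := by
  have h₁' := congrArg (starRingEnd ℂ) h₁
  have h₂' := congrArg (starRingEnd ℂ) h₂
  simp only [map_sub, map_mul, Complex.conj_conj, conj_exp_ofReal_mul_I] at h₁'
  simp only [map_add, map_mul, Complex.conj_conj, ← conj_exp_ofReal_mul_I] at h₂'
  apply Subtype.ext
  change (ofPair a b h).val * (ofPair v w h').val = (ofPair v w h').val * (torus l).val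
  rw [torus_val, ofPair_val, ofPair_val]
  ext i j
  fin_cases i <;> fin_cases j <;> simp [Matrix.mul_apply, Fin.sum_univ_two]
  · linear_combination h₁
  · linear_combination h₂
  · linear_combination -h₂'
  · linear_combination h₁'

/-- Every element of `SU(2)` is conjugate to a diagonal one. -/
theorem exists_conj_torus (x : SU2) :
    ∃ g : SU2, x = g * torus (Real.arccos (halfTrace x)) * g⁻¹ := by
  obtain ⟨h, hx⟩ := exists_eq_ofPair x
  set a := x.val 0 0 with ha
  set b := x.val 0 1 with hb
  set l := Real.arccos (halfTrace x) with hl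
  suffices H : ∃ (v w : ℂ) (h' : Complex.normSq v + Complex.normSq w = 1),
      a * v - b * (starRingEnd ℂ) w = v * Complex.exp (l * Complex.I) ∧
      a * w + b * (starRingEnd ℂ) v = w * Complex.exp (-(l * Complex.I)) by
    obtain ⟨v, w, h', h₁, h₂⟩ := H
    refine ⟨ofPair v w h', ?_⟩
    rw [eq_mul_inv_iff_mul_eq]
    conv_lhs => rw [hx]
    exact ofPair_mul_eq h₁ h₂
  set e := Complex.exp (l * Complex.I) with he
  have hconj : Complex.exp (-(l * Complex.I)) = (starRingEnd ℂ) e := by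
    rw [he, conj_exp_ofReal_mul_I]
  rw [hconj]
  have hee : e * (starRingEnd ℂ) e = 1 := by
    rw [← hconj, he, ← Complex.exp_add]; simp
  have hcos : e + (starRingEnd ℂ) e = a + (starRingEnd ℂ) a := by
    rw [Complex.add_conj, Complex.add_conj, he, Complex.exp_ofReal_mul_I_re, hl,
      Real.cos_arccos (halfTrace_mem_Icc x).1 (halfTrace_mem_Icc x).2]
    rfl
  have hab : a * (starRingEnd ℂ) a + b * (starRingEnd ℂ) b = 1 := by
    rw [Complex.mul_conj, Complex.mul_conj]; exact_mod_cast h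
  -- If `b = 0`, then `x` is already diagonal and `a` is one of the two eigenvalues: conjugate by
  -- the identity or by the Weyl element, which swaps them.
  by_cases hb0 : b = 0
  · rw [hb0] at hab ⊢
    have : (a - e) * (a - (starRingEnd ℂ) e) = 0 := by
      simp at hab
      linear_combination -a * hcos - hab + hee
    rcases mul_eq_zero.mp this with h0 | h0
    · exact ⟨1, 0, by simp, by linear_combination h0, by simp⟩
    · exact ⟨0, 1, by simp, by simp, by linear_combination h0⟩
  · set r := Complex.normSq b + Complex.normSq (e - a) with hr
    have hrpos : 0 < r := by
      have := Complex.normSq_pos.mpr hb0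
      have := Complex.normSq_nonneg (e - a)
      linarith
    have hs : Real.sqrt r ≠ 0 := (Real.sqrt_pos.mpr hrpos).ne'
    have hsC : ((Real.sqrt r : ℝ) : ℂ) ≠ 0 := by exact_mod_cast hs
    -- The first column `(v, -w̄)` of the conjugating matrix is the eigenvector `(b, e - a)` for
    -- `e`, normalized.
    refine ⟨b / (Real.sqrt r : ℝ), -(starRingEnd ℂ) (e - a) / (Real.sqrt r : ℝ), ?_, ?_, ?_⟩
    · rw [Complex.normSq_div, Complex.normSq_div, Complex.normSq_neg, Complex.normSq_conj,
        Complex.normSq_ofReal, Real.mul_self_sqrt hrpos.le, ← add_div, div_self hrpos.ne']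
    · simp only [map_div₀, map_neg, Complex.conj_conj, Complex.conj_ofReal]
      field_simp
      ring
    · simp only [map_div₀, map_sub, Complex.conj_ofReal]
      field_simp
      linear_combination hab - hee + (starRingEnd ℂ) e * hcos

end SU2

/-! ### Matrix coefficients, characters and Schur's lemma for `π_n` -/

namespace SU2

open MvPolynomial

/-- The exponent of the monomial `X₀ ^ j * X₁ ^ (n - j)`. -/
noncomputable def binaryExponent (n j : ℕ) : Fin 2 →₀ ℕ :=
  Finsupp.single 0 j + Finsupp.single 1 (n - j)

theorem monomial_binaryExponent (n j : ℕ) :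
    monomial (binaryExponent n j) (1 : ℂ) = X 0 ^ j * X 1 ^ (n - j) := by
  rw [binaryExponent, X_pow_eq_monomial, X_pow_eq_monomial, monomial_mul, one_mul]

theorem binaryExponent_zero (n j : ℕ) : binaryExponent n j 0 = j := by
  simp [binaryExponent]

theorem binaryExponent_one (n j : ℕ) : binaryExponent n j 1 = n - j := by
  simp [binaryExponent]

theorem degree_binaryExponent {n j : ℕ} (h : j ≤ n) : (binaryExponent n j).degree = n := by
  rw [binaryExponent, map_add, Finsupp.degree_single, Finsupp.degree_single]; omega

theorem binaryExponent_injOn {n j k : ℕ} (h : binaryExponent n j = binaryExponent n k) : j = k := by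
  simpa [binaryExponent_zero] using DFunLike.congr_fun h 0

theorem eq_binaryExponent {n : ℕ} {m : Fin 2 →₀ ℕ} (h : m.degree = n) :
    m = binaryExponent n (m 0) := by
  rw [Finsupp.degree_eq_sum, Fin.sum_univ_two] at h
  ext i
  fin_cases i
  · simp [binaryExponent_zero]
  · simp [binaryExponent_one]; omega

/-- The coordinates of a binary form. -/
noncomputable def formEquiv (n : ℕ) :
    homogeneousSubmodule (Fin 2) ℂ n ≃ₗ[ℂ] (Fin (n + 1) → ℂ) where
  toFun p j := coeff (binaryExponent n j) (p : MvPolynomial (Fin 2) ℂ)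
  map_add' p q := by ext; simp
  map_smul' c p := by ext; simp
  invFun v := ⟨∑ j : Fin (n + 1), monomial (binaryExponent n j) (v j), by
    refine Submodule.sum_mem _ fun j _ => ?_
    exact isHomogeneous_monomial _ (degree_binaryExponent (Nat.lt_succ_iff.mp j.2))⟩
  left_inv p := by
    apply Subtype.ext
    ext m
    simp only [coeff_sum, coeff_monomial]
    by_cases hm : m.degree = n
    · have hlt : m 0 < n + 1 := by
        rw [Finsupp.degree_eq_sum, Fin.sum_univ_two] at hm; omega
      rw [Finset.sum_eq_single ⟨m 0, hlt⟩]
      · rw [if_pos (eq_binaryExponent hm).symm]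
        exact congrArg (fun k => coeff k _) (eq_binaryExponent hm).symm
      · intro j _ hj
        rw [if_neg]
        rintro rfl
        exact hj (Fin.ext (by simp [binaryExponent_zero]))
      · simp
    · rw [(show IsHomogeneous _ n from p.2).coeff_eq_zero hm]
      refine Finset.sum_eq_zero fun j _ => if_neg ?_
      rintro rfl
      exact hm (degree_binaryExponent (Nat.lt_succ_iff.mp j.2))
  right_inv v := by
    ext k
    simp only [coeff_sum, coeff_monomial]
    rw [Finset.sum_eq_single k]
    · simp
    · intro j _ hj
      exact if_neg fun h => hj (Fin.ext (binaryExponent_injOn h))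
    · simp

/-- The monomial basis of the binary forms of degree `n`. -/
noncomputable def formBasis (n : ℕ) :
    Module.Basis (Fin (n + 1)) ℂ (homogeneousSubmodule (Fin 2) ℂ n) :=
  Module.Basis.ofEquivFun (formEquiv n)

theorem formBasis_val (n : ℕ) (j : Fin (n + 1)) :
    (formBasis n j : MvPolynomial (Fin 2) ℂ) = X 0 ^ (j : ℕ) * X 1 ^ (n - j) := by
  rw [← monomial_binaryExponent, formBasis, Module.Basis.coe_ofEquivFun]
  simp only [formEquiv, LinearEquiv.coe_symm_mk]
  change ∑ k : Fin (n + 1), monomial (binaryExponent n k) (Pi.single (M := fun _ => ℂ) j 1 k) = _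
  rw [Finset.sum_eq_single j]
  · simp
  · intro k _ hk
    simp [hk]
  · simp

/-- The matrix of `π_n(x)` in the monomial basis. -/
noncomputable def irrepMatrix (n : ℕ) (x : SU2) : Matrix (Fin (n + 1)) (Fin (n + 1)) ℂ :=
  LinearMap.toMatrix (formBasis n) (formBasis n) (irrep n x)

theorem irrepMatrix_mul (n : ℕ) (x y : SU2) :
    irrepMatrix n (x * y) = irrepMatrix n x * irrepMatrix n y := by
  rw [irrepMatrix, map_mul, LinearMap.toMatrix_mul]; rfl

theorem character_eq_trace (n : ℕ) (x : SU2) : character n x = (irrepMatrix n x).trace :=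
  LinearMap.trace_eq_matrix_trace ℂ (formBasis n) _

theorem irrepMatrix_apply (n : ℕ) (x : SU2) (i j : Fin (n + 1)) :
    irrepMatrix n x i j =
      coeff (binaryExponent n i) (subst x (X 0 ^ (j : ℕ) * X 1 ^ (n - j))) := by
  rw [← formBasis_val, irrepMatrix, LinearMap.toMatrix_apply]
  rfl

theorem subst_X (x : SU2) (j : Fin 2) :
    subst x (X j) = C (x.val 0 j) * X 0 + C (x.val 1 j) * X 1 := by
  simp [subst, Fin.sum_univ_two]

theorem continuous_coeff_subst (p : MvPolynomial (Fin 2) ℂ) :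
    ∀ m, Continuous fun x : SU2 => coeff m (subst x p) := by
  classical
  induction p using MvPolynomial.induction_on with
  | C a =>
    intro m
    simp only [subst, algHom_C]
    exact continuous_const
  | add p q hp hq =>
    intro m
    simp only [map_add, coeff_add]
    exact (hp m).add (hq m)
  | mul_X p j hp =>
    intro m
    have h : ∀ k, Continuous fun x : SU2 => coeff k (subst x (X j)) := fun k => by
      simp only [subst_X, coeff_add, coeff_C_mul]
      exact ((continuous_entry 0 j).mul continuous_const).add
        ((continuous_entry 1 j).mul continuous_const)
    simp only [map_mul, coeff_mul]
    refine continuous_finsetSum _ fun k _ => (hp _).mul (h _)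

theorem continuous_irrepMatrix (n : ℕ) (i j : Fin (n + 1)) :
    Continuous fun x => irrepMatrix n x i j := by
  simp only [irrepMatrix_apply]
  exact continuous_coeff_subst _ _

theorem continuous_character (n : ℕ) : Continuous (character n) := by
  have : character n = fun x => ∑ i, irrepMatrix n x i i := by
    ext x; rw [character_eq_trace]; rfl
  rw [this]
  exact continuous_finsetSum _ fun i _ => continuous_irrepMatrix n i i

theorem character_mul_comm (n : ℕ) (x y : SU2) : character n (x * y) = character n (y * x) := by
  rw [character_eq_trace, character_eq_trace, irrepMatrix_mul, irrepMatrix_mul, Matrix.trace_mul_comm]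

theorem irrepMatrix_torus (n : ℕ) (θ : ℝ) :
    irrepMatrix n (torus θ) = Matrix.diagonal fun j : Fin (n + 1) =>
      Complex.exp (θ * Complex.I) ^ (j : ℕ) * Complex.exp (-(θ * Complex.I)) ^ (n - j) := by
  classical
  ext i j
  rw [irrepMatrix_apply, map_mul, map_pow, map_pow, subst_X, subst_X, torus_val]
  simp only [Matrix.of_apply, Matrix.cons_val', Matrix.cons_val_zero, Matrix.cons_val_one,
    Matrix.cons_val_fin_one, map_zero, zero_mul, add_zero, zero_add, mul_pow]
  rw [show ∀ p q r s : MvPolynomial (Fin 2) ℂ, p * q * (r * s) = (p * r) * (q * s) from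
    fun _ _ _ _ => by ring, ← map_pow, ← map_pow, ← map_mul, coeff_C_mul,
    ← monomial_binaryExponent, coeff_monomial, Matrix.diagonal_apply]
  by_cases h : i = j
  · subst h; simp
  · rw [if_neg h, if_neg fun h' => h (Fin.ext (binaryExponent_injOn h').symm), mul_zero]

theorem character_torus (n : ℕ) (θ : ℝ) :
    character n (torus θ) = (((Polynomial.Chebyshev.U ℝ n).eval (Real.cos θ) : ℝ) : ℂ) := by
  rw [character_eq_trace, irrepMatrix_torus, Matrix.trace_diagonal]
  rw [Polynomial.Chebyshev.complex_ofReal_eval_U]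
  set z := Complex.exp (θ * Complex.I) with hz
  set w := Complex.exp (-(θ * Complex.I)) with hw
  have hzw : z * w = 1 := by rw [hz, hw, ← Complex.exp_add]; simp
  have hcos : z + w = 2 * (Real.cos θ : ℂ) := by
    rw [Complex.ofReal_cos, Complex.cos, hz, hw]; ring_nf
  have hfin : ∀ m : ℕ, ∑ j : Fin (m + 1), z ^ (j : ℕ) * w ^ (m - j) =
      ∑ j ∈ Finset.range (m + 1), z ^ j * w ^ (m - j) := fun m =>
    Fin.sum_univ_eq_sum_range (fun j => z ^ j * w ^ (m - j)) (m + 1)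
  rw [hfin]
  have hs : ∀ m : ℕ, ∑ j ∈ Finset.range (m + 2), z ^ j * w ^ (m + 1 - j) =
      w * (∑ j ∈ Finset.range (m + 1), z ^ j * w ^ (m - j)) + z ^ (m + 1) := by
    intro m
    rw [Finset.sum_range_succ, Finset.mul_sum]
    congr 1
    · refine Finset.sum_congr rfl fun j hj => ?_
      rw [show m + 1 - j = m - j + 1 by have := Finset.mem_range.mp hj; omega]; ring
    · simp
  -- Two consecutive degrees are carried together, since the Chebyshev recurrence has order two.
  have key : ∀ m : ℕ, (∑ j ∈ Finset.range (m + 1), z ^ j * w ^ (m - j) =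
      (Polynomial.Chebyshev.U ℂ m).eval (Real.cos θ : ℂ)) ∧
      (∑ j ∈ Finset.range (m + 2), z ^ j * w ^ (m + 1 - j) =
      (Polynomial.Chebyshev.U ℂ (m + 1 : ℕ)).eval (Real.cos θ : ℂ)) := by
    intro m
    induction m with
    | zero =>
      constructor
      · simp
      · simpa [Finset.sum_range_succ, add_comm] using hcos
    | succ m ih =>
      refine ⟨ih.2, ?_⟩
      have e1 := hs (m + 1)
      have e2 := hs m
      rw [show ((m + 1 + 1 : ℕ) : ℤ) = (m : ℤ) + 2 by push_cast; ring,
        Polynomial.Chebyshev.U_add_two]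
      simp only [Polynomial.eval_sub, Polynomial.eval_mul, Polynomial.eval_ofNat, Polynomial.eval_X]
      rw [← hcos, e1, show ((m : ℤ) + 1) = ((m + 1 : ℕ) : ℤ) by push_cast; ring, ← ih.2, ← ih.1, e2]
      linear_combination -(∑ j ∈ Finset.range (m + 1), z ^ j * w ^ (m - j)) * hzw
  exact (key n).1

theorem character_eq (n : ℕ) (x : SU2) :
    character n x = (((Polynomial.Chebyshev.U ℝ n).eval (halfTrace x) : ℝ) : ℂ) := by
  obtain ⟨g, hg⟩ := exists_conj_torus x
  conv_lhs => rw [hg]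
  rw [character_mul_comm, ← mul_assoc, inv_mul_cancel, one_mul, character_torus,
    Real.cos_arccos (halfTrace_mem_Icc x).1 (halfTrace_mem_Icc x).2]

/-- Schur's lemma for `π_n`: a matrix commuting with `π_n` is scalar. -/
theorem exists_eq_scalar_of_commute (n : ℕ) (A : Matrix (Fin (n + 1)) (Fin (n + 1)) ℂ)
    (hA : ∀ x, irrepMatrix n x * A = A * irrepMatrix n x) : ∃ c : ℂ, A = c • 1 := by
  classical
  -- At angle `π / (n+1)` the diagonal entries of `π_n` are `exp(i(2j - n)π / (n+1))`, pairwise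
  -- distinct for `0 ≤ j ≤ n`; a matrix commuting with this diagonal matrix is diagonal.
  have hoff : ∀ i j, i ≠ j → A i j = 0 := by
    intro i j hij
    have h := congrFun (congrFun (hA (torus (Real.pi / (n + 1)))) i) j
    rw [irrepMatrix_torus, Matrix.diagonal_mul, Matrix.mul_diagonal] at h
    by_contra hne
    have h' := mul_right_cancel₀ hne (h.trans (mul_comm _ _))
    set z : ℂ := ((Real.pi / (n + 1) : ℝ) : ℂ) * Complex.I with hz
    rw [← Complex.exp_nat_mul, ← Complex.exp_nat_mul, ← Complex.exp_nat_mul,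
      ← Complex.exp_nat_mul, ← Complex.exp_add, ← Complex.exp_add,
      Complex.exp_eq_exp_iff_exists_int] at h'
    obtain ⟨k, hk⟩ := h'
    rw [Nat.cast_sub (Nat.lt_succ_iff.mp i.2), Nat.cast_sub (Nat.lt_succ_iff.mp j.2), hz] at hk
    have hn : ((n : ℂ) + 1) ≠ 0 := by exact_mod_cast Nat.succ_ne_zero n
    have hpi : (Real.pi : ℂ) ≠ 0 := by exact_mod_cast Real.pi_ne_zero
    push_cast at hk
    field_simp at hk
    have hk' : ((i : ℕ) : ℂ) = (j : ℕ) + k * (n + 1) := by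
      have h2 : (Real.pi : ℂ) * Complex.I * (((i : ℕ) : ℂ) - ((j : ℕ) + k * (n + 1))) = 0 := by
        linear_combination (Real.pi : ℂ) * Complex.I * hk / 2
      rcases mul_eq_zero.mp h2 with h3 | h3
      · simp [hpi] at h3
      · linear_combination h3
    have hk'' : (i : ℤ) = (j : ℕ) + k * (n + 1) := by exact_mod_cast hk'
    have hi := i.2
    have hj := j.2
    have hk0 : k = 0 := by
      by_contra hk0
      rcases lt_or_gt_of_ne hk0 with h | h
      · nlinarith
      · nlinarith
    rw [hk0] at hk''
    exact hij (Fin.ext (by omega))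
  have hc : ((1 / Real.sqrt 2 : ℝ) : ℂ) ≠ 0 := by
    have : (1 / Real.sqrt 2 : ℝ) ≠ 0 := by positivity
    exact_mod_cast this
  set c : ℂ := ((1 / Real.sqrt 2 : ℝ) : ℂ) with hcdef
  let r : SU2 := ofPair c c (by
    rw [hcdef, Complex.normSq_ofReal]
    rw [div_mul_div_comm, Real.mul_self_sqrt (by norm_num)]; norm_num)
  -- The last column holds the coefficients of `(c X₀ - c X₁)^n`, which are nonzero by the binomial
  -- theorem. Comparing the `(i, last)` entries of the commutation relation for `r` then equates all
  -- diagonal entries of `A`.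
  have hentry : ∀ i : Fin (n + 1), irrepMatrix n r i (Fin.last n) ≠ 0 := by
    intro i
    have hr0 : r.val 0 0 = c := by simp [r, ofPair_val]
    have hr1 : r.val 1 0 = -c := by simp [r, ofPair_val, hcdef]
    rw [irrepMatrix_apply]
    simp only [Fin.val_last, Nat.sub_self, pow_zero, mul_one, map_pow, subst_X, hr0, hr1]
    rw [add_pow, coeff_sum, Finset.sum_eq_single (i : ℕ)]
    · rw [show (C c * X 0) ^ (i : ℕ) * (C (-c) * X 1) ^ (n - (i : ℕ)) * (n.choose i : MvPolynomial (Fin 2) ℂ)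
        = C (c ^ (i : ℕ) * (-c) ^ (n - (i : ℕ)) * (n.choose i : ℂ)) *
          (X 0 ^ (i : ℕ) * X 1 ^ (n - (i : ℕ))) by
          simp only [map_mul, map_pow, map_natCast]; ring,
        coeff_C_mul, ← monomial_binaryExponent, coeff_monomial, if_pos rfl, mul_one]
      have : (n.choose i : ℂ) ≠ 0 := by
        exact_mod_cast (Nat.choose_pos (Nat.lt_succ_iff.mp i.2)).ne'
      exact mul_ne_zero (mul_ne_zero (pow_ne_zero _ hc) (pow_ne_zero _ (neg_ne_zero.mpr hc))) this
    · intro j _ hj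
      rw [show (C c * X 0) ^ j * (C (-c) * X 1) ^ (n - j) * (n.choose j : MvPolynomial (Fin 2) ℂ)
        = C (c ^ j * (-c) ^ (n - j) * (n.choose j : ℂ)) *
          (X 0 ^ j * X 1 ^ (n - j)) by
          simp only [map_mul, map_pow, map_natCast]; ring,
        coeff_C_mul, ← monomial_binaryExponent, coeff_monomial,
        if_neg fun h => hj (binaryExponent_injOn h), mul_zero]
    · intro h
      exact absurd (Finset.mem_range.mpr i.2) h
  have hdiag : A = Matrix.diagonal fun i => A i i := by
    ext i j
    by_cases h : i = j
    · subst h; simp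
    · rw [Matrix.diagonal_apply_ne _ h, hoff i j h]
  refine ⟨A (Fin.last n) (Fin.last n), ?_⟩
  ext i j
  by_cases h : i = j
  · subst h
    have h := congrFun (congrFun (hA r) i) (Fin.last n)
    rw [hdiag, Matrix.mul_diagonal, Matrix.diagonal_mul] at h
    have := mul_left_cancel₀ (hentry i) (h.trans (mul_comm _ _))
    simp [this]
  · simp [h, hoff i j h]

end SU2

/-! ### Uniform convergence of cosine series of Hölder functions -/

section

open Real (sin cos)

/-- The trigonometric Dirichlet kernel `1/2 + cos t + ⋯ + cos (N t)`. -/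
noncomputable def trigDirichletKernel (N : ℕ) (t : ℝ) : ℝ :=
  1 / 2 + ∑ n ∈ Finset.range N, cos (((n + 1 : ℕ) : ℝ) * t)

/-- The cosine Fourier coefficients on `[-π, π]`. -/
noncomputable def cosCoeff (F : ℝ → ℝ) (n : ℕ) : ℝ :=
  (1 / Real.pi) * ∫ t in -Real.pi..Real.pi, F t * cos (n * t)

/-- The partial sums of the cosine series. -/
noncomputable def cosPartialSum (F : ℝ → ℝ) (N : ℕ) (θ : ℝ) : ℝ :=
  cosCoeff F 0 / 2 + ∑ n ∈ Finset.range N, cosCoeff F (n + 1) * cos (((n + 1 : ℕ) : ℝ) * θ)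

theorem continuous_trigDirichletKernel (N : ℕ) : Continuous (trigDirichletKernel N) := by
  unfold trigDirichletKernel; fun_prop

theorem trigDirichletKernel_mul_sin (N : ℕ) (t : ℝ) :
    trigDirichletKernel N t * (2 * sin (t / 2)) = sin ((N + 1 / 2) * t) := by
  induction N with
  | zero => simp [trigDirichletKernel]; ring_nf
  | succ N ih =>
    have h : trigDirichletKernel (N + 1) t =
        trigDirichletKernel N t + cos (((N + 1 : ℕ) : ℝ) * t) := by
      simp only [trigDirichletKernel, Finset.sum_range_succ]; ring
    rw [h, add_mul, ih]
    push_cast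
    rw [show ((N : ℝ) + 1 / 2) * t = (N + 1) * t - t / 2 by ring,
      show ((N : ℝ) + 1 + 1 / 2) * t = (N + 1) * t + t / 2 by ring, Real.sin_add, Real.sin_sub]
    ring

theorem integral_cos_nat_mul {n : ℕ} (hn : n ≠ 0) : ∫ t in -Real.pi..Real.pi, cos (n * t) = 0 := by
  have hn' : (n : ℝ) ≠ 0 := by exact_mod_cast hn
  rw [intervalIntegral.integral_comp_mul_left (fun θ => cos θ) hn', integral_cos]
  simp [Real.sin_nat_mul_pi]

theorem integral_trigDirichletKernel (N : ℕ) : ∫ t in -Real.pi..Real.pi, trigDirichletKernel N t = Real.pi := by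
  simp only [trigDirichletKernel]
  rw [intervalIntegral.integral_add (by simp)
    (Continuous.intervalIntegrable (by fun_prop) _ _), intervalIntegral.integral_finsetSum
    fun n _ => Continuous.intervalIntegrable (by fun_prop) _ _,
    Finset.sum_eq_zero fun n _ => integral_cos_nat_mul (Nat.succ_ne_zero n)]
  simp
  ring

/-- Periodicity moves the shift onto the cosine; in the expansion of `cos (n(u - θ))` the sine part
integrates to zero because `F` is even. -/
theorem integral_shift_mul_cos {F : ℝ → ℝ} (hF : Continuous F)
    (hper : Function.Periodic F (2 * Real.pi)) (heven : ∀ t, F (-t) = F t) (n : ℕ) (θ : ℝ) :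
    ∫ t in -Real.pi..Real.pi, F (θ + t) * cos (n * t) = Real.pi * (cosCoeff F n * cos (n * θ)) := by
  have hsin : ∫ t in -Real.pi..Real.pi, F t * sin (n * t) = 0 := by
    have h := intervalIntegral.integral_comp_neg (a := -Real.pi) (b := Real.pi)
      (fun t => F t * sin (n * t))
    simp only [heven, mul_neg, Real.sin_neg, neg_neg, intervalIntegral.integral_neg] at h
    linarith
  have hshift : ∫ t in -Real.pi..Real.pi, F (θ + t) * cos (n * t) =
      ∫ u in -Real.pi..Real.pi, F u * cos (n * (u - θ)) := by
    have h1 := intervalIntegral.integral_comp_add_left (a := -Real.pi) (b := Real.pi)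
      (fun u => F u * cos (n * (u - θ))) θ
    simp only [add_sub_cancel_left] at h1
    have hp : Function.Periodic (fun u => F u * cos (n * (u - θ))) (2 * Real.pi) := by
      intro u
      simp only [hper u]
      rw [show (n : ℝ) * (u + 2 * Real.pi - θ) = n * (u - θ) + n * (2 * Real.pi) by ring,
        Real.cos_add_nat_mul_two_pi]
    have h2 := hp.intervalIntegral_add_eq (θ + -Real.pi) (-Real.pi)
    rw [show θ + -Real.pi + 2 * Real.pi = θ + Real.pi by ring, show -Real.pi + 2 * Real.pi = Real.pi by ring] at h2
    rw [h1, h2]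
  rw [hshift]
  have : ∀ u, F u * cos (n * (u - θ)) =
      cos (n * θ) * (F u * cos (n * u)) + sin (n * θ) * (F u * sin (n * u)) := by
    intro u
    rw [mul_sub, Real.cos_sub]; ring
  simp only [this]
  rw [intervalIntegral.integral_add (Continuous.intervalIntegrable (by fun_prop) _ _)
    (Continuous.intervalIntegrable (by fun_prop) _ _), intervalIntegral.integral_const_mul,
    intervalIntegral.integral_const_mul, hsin, cosCoeff]
  field_simp
  ring

theorem cosPartialSum_sub {F : ℝ → ℝ} (hF : Continuous F)
    (hper : Function.Periodic F (2 * Real.pi)) (heven : ∀ t, F (-t) = F t) (N : ℕ) (θ : ℝ) :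
    cosPartialSum F N θ - F θ =
      (1 / Real.pi) * ∫ t in -Real.pi..Real.pi, (F (θ + t) - F θ) * trigDirichletKernel N t := by
  have hD := continuous_trigDirichletKernel N
  have h : ∫ t in -Real.pi..Real.pi, F (θ + t) * trigDirichletKernel N t = Real.pi * cosPartialSum F N θ := by
    have h0 := integral_shift_mul_cos hF hper heven 0 θ
    simp only [Nat.cast_zero, zero_mul, Real.cos_zero, mul_one] at h0
    simp only [trigDirichletKernel, mul_add, Finset.mul_sum]
    rw [intervalIntegral.integral_add (Continuous.intervalIntegrable (by fun_prop) _ _)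
      (Continuous.intervalIntegrable (by fun_prop) _ _), intervalIntegral.integral_finsetSum
      fun n _ => Continuous.intervalIntegrable (by fun_prop) _ _,
      Finset.sum_congr rfl fun n _ => integral_shift_mul_cos hF hper heven (n + 1) θ,
      intervalIntegral.integral_mul_const, h0, cosPartialSum, ← Finset.mul_sum]
    ring
  simp only [sub_mul]
  rw [intervalIntegral.integral_sub (Continuous.intervalIntegrable (by fun_prop) _ _)
    (Continuous.intervalIntegrable (by fun_prop) _ _), h, intervalIntegral.integral_const_mul,
    integral_trigDirichletKernel]
  field_simp

theorem intervalIntegrable_abs_rpow {r : ℝ} (hr : -1 < r) (b : ℝ) (hb : 0 ≤ b) :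
    IntervalIntegrable (fun t => |t| ^ r) volume (-b) b := by
  have h1 : IntervalIntegrable (fun t => |t| ^ r) volume 0 b := by
    refine (intervalIntegral.intervalIntegrable_rpow' hr).congr ?_
    intro t ht
    rw [Set.uIoc_of_le hb] at ht
    simp only [abs_of_pos ht.1]
  have h2 : IntervalIntegrable (fun t => |t| ^ r) volume (-b) 0 := by
    have := ((IntervalIntegrable.iff_comp_neg (f := fun t => |t| ^ r)).mp h1).symm
    simpa using this
  exact h2.trans h1

theorem abs_le_pi_mul_abs_sin_half {t : ℝ} (ht : |t| ≤ Real.pi) : |t| ≤ Real.pi * |sin (t / 2)| := by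
  have h := Real.mul_abs_le_abs_sin (x := t / 2) (by rw [abs_div, abs_two]; linarith)
  rw [abs_div, abs_two] at h
  have hpi := Real.pi_pos
  calc |t| = Real.pi * (2 / Real.pi * (|t| / 2)) := by field_simp
    _ ≤ _ := by gcongr

/-- Jordan's inequality `|t| ≤ π |sin(t/2)|` makes the Dini quotient lose one power of `|t|`, so
that it stays integrable when `r > 0`. -/
theorem abs_div_sin_half_le {t x C r : ℝ} (ht : |t| ≤ Real.pi) (hC : 0 ≤ C) (hx : |x| ≤ C * |t| ^ r) :
    |x / (2 * sin (t / 2))| ≤ C * Real.pi * |t| ^ (r - 1) := by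
  rcases eq_or_ne t 0 with rfl | h0
  · simp; positivity
  have htpos : 0 < |t| := abs_pos.mpr h0
  have hs := abs_le_pi_mul_abs_sin_half ht
  have hspos : 0 < |sin (t / 2)| := by
    by_contra h
    nlinarith [Real.pi_pos, abs_nonneg (sin (t / 2))]
  rw [abs_div, abs_mul, abs_two, Real.rpow_sub_one htpos.ne', div_le_iff₀ (by positivity)]
  have hrp : 0 ≤ |t| ^ r := by positivity
  calc |x| ≤ C * |t| ^ r := hx
    _ = C * |t| ^ r / |t| * |t| := by field_simp
    _ ≤ C * |t| ^ r / |t| * (Real.pi * |sin (t / 2)|) := by gcongr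
    _ ≤ C * |t| ^ r / |t| * (Real.pi * |sin (t / 2)|) * 2 := by
      have : 0 ≤ C * |t| ^ r / |t| * (Real.pi * |sin (t / 2)|) := by positivity
      linarith
    _ = _ := by ring

/-- At `t = 0` the right side is `0` by division by zero, hence the condition that `x` vanish there.
-/
theorem mul_trigDirichletKernel {x t : ℝ} (ht : |t| ≤ Real.pi) (hx : t = 0 → x = 0) (N : ℕ) :
    x * trigDirichletKernel N t = x / (2 * sin (t / 2)) * sin ((N + 1 / 2) * t) := by
  rcases eq_or_ne t 0 with h0 | h0
  · simp [hx h0]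
  have hs := abs_le_pi_mul_abs_sin_half ht
  have : sin (t / 2) ≠ 0 := fun h => by
    rw [h, abs_zero, mul_zero] at hs
    exact h0 (abs_eq_zero.mp (le_antisymm hs (abs_nonneg t)))
  rw [← trigDirichletKernel_mul_sin]
  field_simp

theorem tendsto_integral_mul_sin {h : ℝ → ℝ} (hh : IntervalIntegrable h volume (-Real.pi) Real.pi) :
    Tendsto (fun N : ℕ => ∫ t in -Real.pi..Real.pi, h t * sin ((N + 1 / 2) * t)) atTop (𝓝 0) := by
  have hle : -Real.pi ≤ Real.pi := by linarith [Real.pi_pos]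
  set f : ℝ → ℂ := (Set.Ioc (-Real.pi) Real.pi).indicator fun t => (h t : ℂ) with hf
  have hRL := Real.tendsto_integral_exp_smul_cocompact f
  -- The integral is minus the imaginary part of the Fourier transform of `h` cut off to one period,
  -- at frequency `(N + 1/2) / (2π)`; the Riemann–Lebesgue lemma applies.
  have hw : Tendsto (fun N : ℕ => ((N : ℝ) + 1 / 2) / (2 * Real.pi)) atTop (cocompact ℝ) :=
    ((tendsto_natCast_atTop_atTop.atTop_add tendsto_const_nhds).atTop_div_const
      (by positivity)).mono_right atTop_le_cocompact
  have hlim := ((Complex.continuous_im.tendsto _).comp (hRL.comp hw)).neg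
  simp only [Complex.zero_im, neg_zero] at hlim
  refine hlim.congr fun N => ?_
  have hhi : IntegrableOn (fun t => (h t : ℂ)) (Set.Ioc (-Real.pi) Real.pi) :=
    ((intervalIntegrable_iff_integrableOn_Ioc_of_le hle).mp hh).ofReal
  have hfi : Integrable f := hhi.integrable_indicator measurableSet_Ioc
  have hint : Integrable fun v : ℝ =>
      Real.fourierChar (-(v * (((N : ℝ) + 1 / 2) / (2 * Real.pi)))) • f v := by
    refine hfi.norm.mono' ?_ (ae_of_all _ fun v => by simp)
    have hc : Continuous fun v : ℝ => -(v * (((N : ℝ) + 1 / 2) / (2 * Real.pi))) := by fun_prop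
    exact (Real.continuous_fourierChar.comp hc).aestronglyMeasurable.smul hfi.aestronglyMeasurable
  simp only [Function.comp_apply]
  change -(Complex.imCLM _) = _
  rw [← ContinuousLinearMap.integral_comp_comm _ hint, ← integral_neg,
    intervalIntegral.integral_of_le hle, ← integral_indicator measurableSet_Ioc]
  refine integral_congr_ae (ae_of_all _ fun v => ?_)
  simp only [hf, Complex.imCLM_apply]
  by_cases hv : v ∈ Set.Ioc (-Real.pi) Real.pi
  · rw [Set.indicator_of_mem hv, Set.indicator_of_mem hv, Circle.smul_def, Real.fourierChar_apply,
      smul_eq_mul, Complex.im_mul_ofReal, Complex.exp_ofReal_mul_I_im]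
    rw [show 2 * Real.pi * -(v * (((N : ℝ) + 1 / 2) / (2 * Real.pi))) = -((N + 1 / 2) * v) by
      field_simp, Real.sin_neg]
    ring
  · simp [Set.indicator_of_notMem hv]

/-- The Dini–Lipschitz test: the cosine series of an even Hölder continuous `2π`-periodic function
converges to it uniformly. -/
theorem tendstoUniformlyOn_cosPartialSum {F : ℝ → ℝ} {M α : ℝ} (hM : 0 ≤ M) (hα : 0 < α)
    (hper : Function.Periodic F (2 * Real.pi)) (heven : ∀ t, F (-t) = F t) (hF : Continuous F)
    (hHol : ∀ s t, |F s - F t| ≤ M * |s - t| ^ α) :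
    TendstoUniformlyOn (cosPartialSum F) F atTop (Set.Icc 0 Real.pi) := by
  have hpi := Real.pi_pos
  have hle : -Real.pi ≤ Real.pi := by linarith
  have hmem : ∀ t ∈ Set.uIoc (-Real.pi) Real.pi, |t| ≤ Real.pi := fun t ht => by
    rw [Set.uIoc_of_le hle] at ht
    exact abs_le.mpr ⟨ht.1.le, ht.2⟩
  have hmem' : ∀ t ∈ Set.uIcc (-Real.pi) Real.pi, |t| ≤ Real.pi := fun t ht => by
    rw [Set.uIcc_of_le hle] at ht
    exact abs_le.mpr ht
  have hE : ∀ N θ, cosPartialSum F N θ - F θ = (1 / Real.pi) * ∫ t in -Real.pi..Real.pi,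
      (F (θ + t) - F θ) / (2 * sin (t / 2)) * sin ((N + 1 / 2) * t) := by
    intro N θ
    rw [cosPartialSum_sub hF hper heven]
    congr 1
    refine intervalIntegral.integral_congr fun t ht => ?_
    exact mul_trigDirichletKernel (hmem' t ht) (fun h => by simp [h]) N
  -- Pointwise convergence is Riemann–Lebesgue, the Dini quotient being dominated by a multiple of
  -- `|t|^(α-1)`.
  have hpt : ∀ θ, Tendsto (fun N => cosPartialSum F N θ - F θ) atTop (𝓝 0) := by
    intro θ
    simp only [hE]
    rw [show (0 : ℝ) = 1 / Real.pi * 0 by simp]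
    refine (tendsto_integral_mul_sin ?_).const_mul _
    refine ((intervalIntegrable_abs_rpow (r := α - 1) (by linarith) Real.pi hpi.le).const_mul
      (M * Real.pi)).mono_fun' ?_ ?_
    · exact Measurable.aestronglyMeasurable (by fun_prop)
    · refine (ae_restrict_iff' measurableSet_uIoc).mpr (ae_of_all _ fun t ht => ?_)
      refine abs_div_sin_half_le (hmem t ht) hM ?_
      simpa using hHol (θ + t) θ
  set C : ℝ := (1 / Real.pi) * |∫ t in -Real.pi..Real.pi, 2 * M * Real.pi * |t| ^ (α / 2 - 1)| with hC
  -- The errors are equicontinuous: `C` does not depend on `N`. On a compact interval this upgrades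
  -- pointwise to uniform convergence.
  have hequi : ∀ N θ θ', |(cosPartialSum F N θ' - F θ') - (cosPartialSum F N θ - F θ)| ≤
      C * |θ' - θ| ^ (α / 2) := by
    intro N θ θ'
    have hD := continuous_trigDirichletKernel N
    rw [cosPartialSum_sub hF hper heven, cosPartialSum_sub hF hper heven, ← mul_sub, abs_mul,
      abs_of_pos (by positivity : 0 < 1 / Real.pi), hC, mul_assoc]
    refine mul_le_mul_of_nonneg_left ?_ (by positivity)
    rw [← intervalIntegral.integral_sub (Continuous.intervalIntegrable (by fun_prop) _ _)
      (Continuous.intervalIntegrable (by fun_prop) _ _)]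
    have hnn : 0 ≤ |θ' - θ| ^ (α / 2) := by positivity
    rw [← abs_of_nonneg hnn, ← abs_mul, ← intervalIntegral.integral_mul_const]
    refine intervalIntegral.norm_integral_le_abs_of_norm_le (E := ℝ)
      ((ae_restrict_iff' measurableSet_uIoc).mpr (ae_of_all _ fun t ht => ?_))
      (((intervalIntegrable_abs_rpow (r := α / 2 - 1) (by linarith) Real.pi hpi.le).const_mul
        (2 * M * Real.pi)).mul_const _)
    rw [← sub_mul, mul_trigDirichletKernel (hmem t ht) (fun h => by simp [h]), Real.norm_eq_abs,
      abs_mul]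
    have hx : |F (θ' + t) - F θ' - (F (θ + t) - F θ)| ≤
        (2 * M * |θ' - θ| ^ (α / 2)) * |t| ^ (α / 2) := by
      have h1 : |F (θ' + t) - F θ' - (F (θ + t) - F θ)| ≤ 2 * M * |t| ^ α := by
        have ha := hHol (θ' + t) θ'
        have hb := hHol (θ + t) θ
        rw [add_sub_cancel_left] at ha hb
        rw [abs_le] at *
        constructor <;> linarith
      have h2 : |F (θ' + t) - F θ' - (F (θ + t) - F θ)| ≤ 2 * M * |θ' - θ| ^ α := by
        have ha := hHol (θ' + t) (θ + t)
        have hb := hHol θ' θ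
        rw [add_sub_add_right_eq_sub] at ha
        rw [abs_le] at *
        constructor <;> linarith
      have hsq : ∀ a : ℝ, |a| ^ α = (|a| ^ (α / 2)) ^ 2 := fun a => by
        rw [← Real.rpow_natCast, ← Real.rpow_mul (abs_nonneg a)]
        norm_num
      -- The geometric mean of `h1` and `h2` spends half of the exponent on `|t|`, which keeps
      -- `|t|^(α/2 - 1)` integrable, and half on `|θ' - θ|`.
      refine (pow_le_pow_iff_left₀ (abs_nonneg _) (by positivity) two_ne_zero).mp ?_
      calc |F (θ' + t) - F θ' - (F (θ + t) - F θ)| ^ 2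
          = |F (θ' + t) - F θ' - (F (θ + t) - F θ)| *
            |F (θ' + t) - F θ' - (F (θ + t) - F θ)| := by ring
        _ ≤ (2 * M * |t| ^ α) * (2 * M * |θ' - θ| ^ α) :=
          mul_le_mul h1 h2 (abs_nonneg _) (by positivity)
        _ = _ := by rw [hsq, hsq]; ring
    have hb := abs_div_sin_half_le (hmem t ht) (by positivity) hx
    have hs := Real.abs_sin_le_one ((N + 1 / 2) * t)
    calc _ ≤ |(F (θ' + t) - F θ' - (F (θ + t) - F θ)) / (2 * sin (t / 2))| * 1 := by gcongr
      _ ≤ _ := by rw [mul_one]; exact hb.trans (le_of_eq (by ring))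
  rw [← tendstoLocallyUniformlyOn_iff_tendstoUniformlyOn_of_compact isCompact_Icc,
    Metric.tendstoLocallyUniformlyOn_iff]
  intro ε hε θ _
  have hcont : Continuous fun θ' => C * |θ' - θ| ^ (α / 2) :=
    continuous_const.mul ((by fun_prop : Continuous fun θ' => |θ' - θ|).rpow_const
      fun _ => Or.inr (by positivity))
  have hlt : ∀ᶠ θ' in 𝓝 θ, C * |θ' - θ| ^ (α / 2) < ε / 2 := by
    refine hcont.continuousAt.eventually_lt_const ?_
    simp [Real.zero_rpow (by positivity : α / 2 ≠ 0), hε]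
  refine ⟨{θ' | C * |θ' - θ| ^ (α / 2) < ε / 2}, mem_nhdsWithin_of_mem_nhds hlt, ?_⟩
  have hev := (hpt θ).eventually (Metric.ball_mem_nhds 0 (half_pos hε))
  filter_upwards [hev] with N hN θ' hθ'
  rw [dist_zero_right, Real.norm_eq_abs] at hN
  rw [dist_comm, Real.dist_eq]
  have h1 := hequi N θ θ'
  have h2 : C * |θ' - θ| ^ (α / 2) < ε / 2 := hθ'
  have h3 := h1.trans_lt h2
  rw [abs_lt] at *
  constructor <;> linarith [h3.1, h3.2, hN.1, hN.2]

end

/-! ### Haar measure, class functions and convolution with characters -/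

namespace SU2

instance instIsHaarMeasureHaar : haar.IsHaarMeasure := by
  unfold haar; infer_instance

instance instIsProbabilityMeasureHaar : IsProbabilityMeasure haar :=
  ⟨by simpa [haar] using Measure.haarMeasure_self (K₀ := (⊤ : TopologicalSpace.PositiveCompacts SU2))⟩

instance instSecondCountableTopology : SecondCountableTopology SU2 :=
  have : SecondCountableTopology (Matrix (Fin 2) (Fin 2) ℂ) :=
    inferInstanceAs (SecondCountableTopology (Fin 2 → Fin 2 → ℂ))
  inferInstanceAs (SecondCountableTopology
    (Matrix.specialUnitaryGroup (Fin 2) ℂ : Set (Matrix (Fin 2) (Fin 2) ℂ)))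

/-- The right translate of `haar` is again a Haar probability measure, and such a measure is unique.
-/
instance instIsMulRightInvariantHaar : haar.IsMulRightInvariant where
  map_mul_right_eq_self g := by
    have : IsProbabilityMeasure (haar.map (· * g)) :=
      Measure.isProbabilityMeasure_map (continuous_mul_const g).aemeasurable
    exact Measure.isHaarMeasure_eq_of_isProbabilityMeasure _ _

instance instIsInvInvariantHaar : haar.IsInvInvariant where
  inv_eq_self := by
    have : IsProbabilityMeasure haar.inv :=
      Measure.isProbabilityMeasure_map continuous_inv.aemeasurable
    have : haar.inv.IsHaarMeasure := {}
    exact Measure.isHaarMeasure_eq_of_isProbabilityMeasure _ _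

theorem integrable_of_continuous {E : Type*} [NormedAddCommGroup E]
    [SecondCountableTopologyEither SU2 E] {f : SU2 → E} (hf : Continuous f) :
    Integrable f haar :=
  hf.integrable_of_hasCompactSupport (HasCompactSupport.of_compactSpace f)

theorem continuous_distance : Continuous fun p : SU2 × SU2 => distance p.1 p.2 := by
  unfold distance
  have h : Continuous fun p : SU2 × SU2 => p.1.val - p.2.val :=
    (continuous_subtype_val.comp continuous_fst).sub (continuous_subtype_val.comp continuous_snd)
  exact Real.continuous_sqrt.comp
    (continuous_const.mul (Complex.continuous_re.comp (h.mul h.star).matrix_trace))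

theorem distance_self (x : SU2) : distance x x = 0 := by
  simp [distance]

theorem IsHolder.continuous {α : ℝ} (hα : 0 < α) {f : SU2 → ℝ} (hf : IsHolder α f) :
    Continuous f := by
  obtain ⟨M, -, hM⟩ := hf
  rw [continuous_iff_continuousAt]
  intro x
  rw [ContinuousAt, tendsto_iff_dist_tendsto_zero]
  have h : Tendsto (fun y => M * distance y x ^ α) (𝓝 x) (𝓝 0) := by
    have hc : Continuous fun y => M * distance y x ^ α :=
      continuous_const.mul ((continuous_distance.comp
        (continuous_id.prodMk continuous_const)).rpow_const fun _ => Or.inr hα.le)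
    have := hc.tendsto x
    simpa [distance_self, Real.zero_rpow hα.ne'] using this
  exact squeeze_zero (fun _ => dist_nonneg) (fun y => hM y x) h

/-- The squared distance is `2 - 2 cos(s - t)`, at most `(s - t)^2`. This passes the Hölder bound on
to the torus. -/
theorem distance_torus_le (s t : ℝ) : distance (torus s) (torus t) ≤ |s - t| := by
  rw [distance, ← Real.sqrt_sq_eq_abs]
  apply Real.sqrt_le_sqrt
  have h : (Matrix.trace (((torus s).val - (torus t).val) *
      star ((torus s).val - (torus t).val))).re = 2 * (2 - 2 * Real.cos (s - t)) := by
    rw [torus_val, torus_val, ← conj_exp_ofReal_mul_I, ← conj_exp_ofReal_mul_I,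
      Matrix.trace_fin_two, Matrix.mul_apply, Matrix.mul_apply]
    simp [Fin.sum_univ_two, Matrix.star_apply, Complex.exp_ofReal_mul_I_re, Complex.exp_ofReal_mul_I_im, Real.cos_sub]
    nlinarith [Real.sin_sq_add_cos_sq s, Real.sin_sq_add_cos_sq t]
  rw [h]
  have := Real.one_sub_sq_div_two_le_cos (x := s - t)
  linarith

theorem continuous_conv {f g : SU2 → ℂ} (hf : Continuous f) (hg : Continuous g) :
    Continuous (conv f g) := by
  have h : Continuous (Function.uncurry fun x y : SU2 => f (x * y⁻¹) * g y) := by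
    unfold Function.uncurry; fun_prop
  unfold conv
  simpa using continuous_parametric_integral_of_continuous (μ := haar) h isCompact_univ

theorem conv_eq_integral_inv_mul (f g : SU2 → ℂ) (x : SU2) :
    conv g f x = ∫ y, f (y⁻¹ * x) * g y ∂haar := by
  rw [conv, ← integral_div_left_eq_self (fun y => f (y⁻¹ * x) * g y) haar x]
  refine integral_congr_ae (ae_of_all _ fun y => ?_)
  simp [div_eq_mul_inv, mul_comm]

theorem mul_comm_of_isCentral {f : SU2 → ℝ} (hf : Continuous f)
    (hc : IsCentral fun x => (f x : ℂ)) (x y : SU2) : f (x * y) = f (y * x) := by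
  -- Testing centrality against this `h` at the point `x` gives `(f ∗ h - h ∗ f)(x) = ∫ h²`, so `h`
  -- vanishes identically. Continuity turns almost everywhere into everywhere.
  set h : SU2 → ℝ := fun z => f (x * z⁻¹) - f (z⁻¹ * x) with hh
  have hcont : Continuous h := by rw [hh]; fun_prop
  have hfC : Continuous fun x => (f x : ℂ) := Complex.continuous_ofReal.comp hf
  have hhC : Continuous fun x => (h x : ℂ) := Complex.continuous_ofReal.comp hcont
  have hae := hc.2 (fun z => (h z : ℂ)) (integrable_of_continuous hhC)
  have heq := ((continuous_conv hfC hhC).ae_eq_iff_eq haar (continuous_conv hhC hfC)).mp hae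
  have hx := congrFun heq x
  rw [conv_eq_integral_inv_mul (fun x => (f x : ℂ)), conv, ← sub_eq_zero, ← integral_sub] at hx
  · have hx' : ∫ z, h z ^ 2 ∂haar = 0 := by
      have : ((∫ z, h z ^ 2 ∂haar : ℝ) : ℂ) = 0 := by
        rw [← integral_complex_ofReal, ← hx]
        refine integral_congr_ae (ae_of_all _ fun z => ?_)
        simp only [hh]; push_cast; ring
      exact_mod_cast this
    rw [integral_eq_zero_iff_of_nonneg (fun z => sq_nonneg _)
      (integrable_of_continuous (hcont.pow 2))] at hx'
    have := congrFun (Measure.eq_of_ae_eq (μ := haar) hx' (hcont.pow 2) continuous_zero) y⁻¹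
    simp only [hh, inv_inv, Pi.zero_apply] at this
    exact sub_eq_zero.mp (pow_eq_zero_iff (two_ne_zero) |>.mp this)
  · exact integrable_of_continuous (by fun_prop)
  · exact integrable_of_continuous (by fun_prop)

theorem eq_torus_of_mul_comm {R : Type*} {f : SU2 → R} (hf : ∀ x y, f (x * y) = f (y * x))
    (x : SU2) : f x = f (torus (Real.arccos (halfTrace x))) := by
  obtain ⟨g, hg⟩ := exists_conj_torus x
  conv_lhs => rw [hg]
  rw [hf, ← mul_assoc, inv_mul_cancel, one_mul]

theorem halfTrace_inv (x : SU2) : halfTrace x⁻¹ = halfTrace x := by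
  change ((star x.val) 0 0).re = _
  simp [Matrix.star_apply, halfTrace]

theorem inv_eq_of_mul_comm {R : Type*} {f : SU2 → R} (hf : ∀ x y, f (x * y) = f (y * x))
    (x : SU2) : f x⁻¹ = f x := by
  rw [eq_torus_of_mul_comm hf, halfTrace_inv, ← eq_torus_of_mul_comm hf]

/-- The operator `A = ∫ f(y⁻¹) π_n(y) dy` commutes with `π_n` because `f` is a class function, so it
is a scalar `c` by Schur. Then `f ∗ χ_n = tr(A π_n) = c χ_n`, and `(n+1) c = tr A = ∫ f χ_n` since
`f(y⁻¹) = f(y)`. -/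
theorem conv_character {f : SU2 → ℂ} (hf : Continuous f) (hcl : ∀ x y, f (x * y) = f (y * x))
    (n : ℕ) (x : SU2) :
    (n + 1) * conv f (character n) x = (∫ y, f y * character n y ∂haar) * character n x := by
  set A : Matrix (Fin (n + 1)) (Fin (n + 1)) ℂ :=
    fun i j => ∫ y, f y⁻¹ * irrepMatrix n y i j ∂haar with hA
  have hint : ∀ i j, Integrable (fun y => f y⁻¹ * irrepMatrix n y i j) haar := fun i j =>
    integrable_of_continuous ((hf.comp continuous_inv).mul (continuous_irrepMatrix n i j))
  have hright : ∀ (g : SU2) i j,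
      (A * irrepMatrix n g) i j = ∫ y, f y⁻¹ * irrepMatrix n (y * g) i j ∂haar := by
    intro g i j
    simp only [irrepMatrix_mul, Matrix.mul_apply, Finset.mul_sum]
    rw [integral_finsetSum]
    · refine Finset.sum_congr rfl fun k _ => ?_
      rw [hA, ← integral_mul_const]
      exact integral_congr_ae (ae_of_all _ fun y => by ring)
    · intro k _
      simpa only [mul_assoc] using (hint i k).mul_const (irrepMatrix n g k j)
  have hleft : ∀ (g : SU2) i j,
      (irrepMatrix n g * A) i j = ∫ y, f y⁻¹ * irrepMatrix n (g * y) i j ∂haar := by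
    intro g i j
    simp only [irrepMatrix_mul, Matrix.mul_apply, Finset.mul_sum]
    rw [integral_finsetSum]
    · refine Finset.sum_congr rfl fun k _ => ?_
      rw [hA, ← integral_const_mul]
      exact integral_congr_ae (ae_of_all _ fun y => by ring)
    · intro k _
      simpa only [mul_left_comm] using (hint k j).const_mul (irrepMatrix n g i k)
  obtain ⟨c, hc⟩ := exists_eq_scalar_of_commute n A fun g => by
    ext i j
    rw [hright, hleft, ← integral_mul_left_eq_self (fun y => f y⁻¹ * irrepMatrix n (g * y) i j) g⁻¹,
      ← integral_mul_right_eq_self (fun y => f y⁻¹ * irrepMatrix n (y * g) i j) g⁻¹]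
    refine integral_congr_ae (ae_of_all _ fun y => ?_)
    simp [hcl]
  have hconv : conv f (character n) x = (A * irrepMatrix n x).trace := by
    rw [conv, ← integral_mul_right_eq_self _ x, Matrix.trace]
    simp only [Matrix.diag_apply, hright]
    rw [← integral_finsetSum]
    · refine integral_congr_ae (ae_of_all _ fun y => ?_)
      simp [character_eq_trace, Matrix.trace, Finset.mul_sum]
    · intro i _
      exact integrable_of_continuous ((hf.comp continuous_inv).mul
        ((continuous_irrepMatrix n i i).comp (continuous_mul_const x)))
  have htr : ∫ y, f y * character n y ∂haar = A.trace := by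
    simp only [Matrix.trace, Matrix.diag_apply]
    rw [hA, ← integral_finsetSum _ fun i _ => hint i i]
    refine integral_congr_ae (ae_of_all _ fun y => ?_)
    simp [character_eq_trace, Matrix.trace, Finset.mul_sum, inv_eq_of_mul_comm hcl]
  rw [hconv, htr, hc, character_eq_trace]
  simp
  ring

/-! ### Weyl's integration formula and Fourier sums of class functions -/

open Polynomial.Chebyshev

/-- For `f = 1`, `conv_character` reads `(n+1) ∫ χ_n = (∫ χ_n) χ_n(x)`; evaluate at a zero of `χ_n`,
the torus element of angle `π / (n+1)`. -/
theorem integral_character {n : ℕ} (hn : n ≠ 0) : ∫ y, character n y ∂haar = 0 := by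
  have hone : ∀ x, conv (fun _ => 1) (character n) x = ∫ y, character n y ∂haar := fun x => by
    simp [conv]
  have h := conv_character (f := fun _ => 1) continuous_const (fun _ _ => rfl) n
    (torus (Real.pi / (n + 1)))
  have hzero : character n (torus (Real.pi / (n + 1))) = 0 := by
    have h1 := U_real_cos (Real.pi / (n + 1)) n
    have hn1 : (1 : ℝ) ≤ n := by exact_mod_cast Nat.one_le_iff_ne_zero.mpr hn
    have hsin : 0 < Real.sin (Real.pi / (n + 1)) := by
      apply Real.sin_pos_of_pos_of_lt_pi
      · positivity
      · rw [div_lt_iff₀ (by positivity)]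
        nlinarith [Real.pi_pos]
    rw [Int.cast_natCast, mul_div_cancel₀ _ (by positivity), Real.sin_pi] at h1
    rw [character_torus, (mul_eq_zero.mp h1).resolve_right hsin.ne', Complex.ofReal_zero]
  rw [hone, hzero, mul_zero] at h
  have hn1 : ((n : ℂ) + 1) ≠ 0 := by exact_mod_cast Nat.succ_ne_zero n
  exact (mul_eq_zero.mp h).resolve_left hn1

theorem integral_sin_mul_sin (n : ℕ) : ∫ θ in -Real.pi..Real.pi,
    Real.sin ((n + 1) * θ) * Real.sin θ = if n = 0 then Real.pi else 0 := by
  have h : ∀ θ : ℝ, Real.sin ((n + 1) * θ) * Real.sin θ =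
      (1 / 2) * (Real.cos (n * θ) - Real.cos ((n + 2) * θ)) := by
    intro θ
    rw [show (n : ℝ) * θ = (n + 1) * θ - θ by ring, show ((n : ℝ) + 2) * θ = (n + 1) * θ + θ by ring,
      Real.cos_sub, Real.cos_add]
    ring
  have h2 := integral_cos_nat_mul (n := n + 2) (by omega)
  push_cast at h2
  simp only [h]
  rw [intervalIntegral.integral_const_mul, intervalIntegral.integral_sub
    (Continuous.intervalIntegrable (by fun_prop) _ _)
    (Continuous.intervalIntegrable (by fun_prop) _ _), h2]
  split_ifs with hn
  · subst hn; simp; ring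
  · rw [integral_cos_nat_mul hn]; simp

/-- Both sides are linear in `p` and agree on every `U_n`. The relation `2 X U_n = U_{n+1} +
U_{n-1}` propagates this to `X^k U_n`, and `n = 0` gives all monomials. -/
theorem weyl_integral_polynomial (p : Polynomial ℝ) : ∫ y, p.eval (halfTrace y) ∂haar =
    (1 / Real.pi) * ∫ θ in -Real.pi..Real.pi, p.eval (Real.cos θ) * Real.sin θ ^ 2 := by
  let L : Polynomial ℝ →ₗ[ℝ] ℝ :=
    { toFun := fun p => (∫ y, p.eval (halfTrace y) ∂haar) -
        (1 / Real.pi) * ∫ θ in -Real.pi..Real.pi, p.eval (Real.cos θ) * Real.sin θ ^ 2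
      map_add' := fun p q => by
        simp only [Polynomial.eval_add, add_mul]
        have hc : ∀ r : Polynomial ℝ, Integrable (fun y => r.eval (halfTrace y)) haar := fun r =>
          integrable_of_continuous (r.continuous.comp continuous_halfTrace)
        rw [integral_add (hc p) (hc q),
          intervalIntegral.integral_add
          (Continuous.intervalIntegrable (by fun_prop) _ _)
          (Continuous.intervalIntegrable (by fun_prop) _ _)]
        ring
      map_smul' := fun c p => by
        simp only [Polynomial.eval_smul, smul_eq_mul, mul_assoc, RingHom.id_apply]
        rw [integral_const_mul, intervalIntegral.integral_const_mul]
        ring }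
  suffices H : ∀ p, L p = 0 from sub_eq_zero.mp (H p)
  have hU : ∀ n : ℕ, L (U ℝ n) = 0 := by
    intro n
    have h1 : ∫ y, (U ℝ n).eval (halfTrace y) ∂haar = if n = 0 then 1 else 0 := by
      split_ifs with hn
      · subst hn; simp
      · have := integral_character hn
        simp only [character_eq] at this
        rw [integral_complex_ofReal] at this
        exact_mod_cast this
    have h2 : ∫ θ in -Real.pi..Real.pi, (U ℝ n).eval (Real.cos θ) * Real.sin θ ^ 2 =
        if n = 0 then Real.pi else 0 := by
      rw [← integral_sin_mul_sin]
      refine intervalIntegral.integral_congr fun θ _ => ?_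
      have := U_real_cos θ n
      rw [Int.cast_natCast] at this
      simp only [← this]; ring
    change (∫ y, (U ℝ n).eval (halfTrace y) ∂haar) - (1 / Real.pi) *
      ∫ θ in -Real.pi..Real.pi, (U ℝ n).eval (Real.cos θ) * Real.sin θ ^ 2 = 0
    rw [h1, h2]
    split_ifs
    · field_simp; ring
    · simp
  have hXU : ∀ k n : ℕ, L (Polynomial.X ^ k * U ℝ n) = 0 := by
    intro k
    induction k with
    | zero => intro n; simpa using hU n
    | succ k ih =>
      intro n
      cases n with
      | zero =>
        have : (Polynomial.X ^ (k + 1) * U ℝ ((0 : ℕ) : ℤ)) =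
            (1 / 2 : ℝ) • (Polynomial.X ^ k * U ℝ ((1 : ℕ) : ℤ)) := by
          rw [Polynomial.smul_eq_C_mul]
          simp only [Nat.cast_zero, Nat.cast_one, U_zero, U_one]
          rw [show (2 : Polynomial ℝ) = Polynomial.C 2 from rfl]
          linear_combination -Polynomial.X ^ (k + 1) * (by rw [← Polynomial.C_mul]; norm_num :
            Polynomial.C (1 / 2 : ℝ) * Polynomial.C 2 = 1)
        rw [this, map_smul, ih, smul_zero]
      | succ n =>
        have : (Polynomial.X ^ (k + 1) * U ℝ ((n + 1 : ℕ) : ℤ)) =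
            (1 / 2 : ℝ) • (Polynomial.X ^ k * U ℝ ((n + 2 : ℕ) : ℤ) +
              Polynomial.X ^ k * U ℝ (n : ℤ)) := by
          rw [Polynomial.smul_eq_C_mul]
          push_cast
          rw [U_add_two, show (2 : Polynomial ℝ) = Polynomial.C 2 from rfl]
          linear_combination -Polynomial.X ^ (k + 1) * U ℝ ((n : ℤ) + 1) *
            (by rw [← Polynomial.C_mul]; norm_num :
              Polynomial.C (1 / 2 : ℝ) * Polynomial.C 2 = 1)
        rw [this, map_smul, map_add, ih, ih, add_zero, smul_zero]
  intro p
  induction p using Polynomial.induction_on' with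
  | add p q hp hq => rw [map_add, hp, hq, add_zero]
  | monomial n a =>
    have := hXU n 0
    rw [Nat.cast_zero, U_zero, mul_one] at this
    rw [← Polynomial.smul_X_eq_monomial, map_smul, this, smul_zero]

/-- Weyl's integration formula for continuous class functions on `SU(2)`. -/
theorem weyl_integral {f : SU2 → ℝ} (hf : Continuous f) (hcl : ∀ x y, f (x * y) = f (y * x)) :
    ∫ y, f y ∂haar =
      (1 / Real.pi) * ∫ θ in -Real.pi..Real.pi, f (torus θ) * Real.sin θ ^ 2 := by
  refine eq_of_forall_dist_le fun ε hε => ?_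
  rw [Real.dist_eq]
  have hG : Continuous fun t => f (torus (Real.arccos t)) :=
    hf.comp (continuous_torus.comp Real.continuous_arccos)
  -- A class function is a continuous function of the half trace, so Weierstrass approximation
  -- reduces the formula to polynomials.
  obtain ⟨p, hp⟩ := exists_polynomial_near_of_continuousOn (-1) 1
    (fun t => f (torus (Real.arccos t))) hG.continuousOn (ε / 3) (by positivity)
  have hp' : ∀ y, |p.eval (halfTrace y) - f y| ≤ ε / 3 := fun y => by
    rw [eq_torus_of_mul_comm hcl y]
    exact (hp _ (halfTrace_mem_Icc y)).le
  have hpc : Continuous fun y => p.eval (halfTrace y) := p.continuous.comp continuous_halfTrace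
  have h1 : |(∫ y, p.eval (halfTrace y) ∂haar) - ∫ y, f y ∂haar| ≤ ε / 3 := by
    rw [← integral_sub (integrable_of_continuous hpc) (integrable_of_continuous hf)]
    have := norm_integral_le_of_norm_le_const (μ := haar)
      (f := fun y => p.eval (halfTrace y) - f y) (ae_of_all _ hp')
    simpa using this
  have h2 : |(∫ θ in -Real.pi..Real.pi, p.eval (Real.cos θ) * Real.sin θ ^ 2) -
      ∫ θ in -Real.pi..Real.pi, f (torus θ) * Real.sin θ ^ 2| ≤ ε / 3 * (2 * Real.pi) := by
    have hfc : Continuous fun θ => f (torus θ) := hf.comp continuous_torus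
    rw [← intervalIntegral.integral_sub (Continuous.intervalIntegrable (by fun_prop) _ _)
      (Continuous.intervalIntegrable (by fun_prop) _ _)]
    have := intervalIntegral.norm_integral_le_of_norm_le_const (a := -Real.pi) (b := Real.pi)
      (f := fun θ => p.eval (Real.cos θ) * Real.sin θ ^ 2 - f (torus θ) * Real.sin θ ^ 2)
      (C := ε / 3) fun θ _ => by
        rw [← sub_mul, norm_mul, Real.norm_eq_abs, Real.norm_eq_abs]
        have ha := hp' (torus θ)
        rw [halfTrace_torus] at ha
        have hb : |Real.sin θ ^ 2| ≤ 1 := by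
          rw [abs_of_nonneg (sq_nonneg _)]; exact Real.sin_sq_le_one θ
        nlinarith [abs_nonneg (p.eval (Real.cos θ) - f (torus θ)), abs_nonneg (Real.sin θ ^ 2)]
    rwa [Real.norm_eq_abs, show |Real.pi - -Real.pi| = 2 * Real.pi by
      rw [abs_of_nonneg] <;> linarith [Real.pi_pos]] at this
  rw [weyl_integral_polynomial] at h1
  have h3 : |(1 / Real.pi) * (∫ θ in -Real.pi..Real.pi, p.eval (Real.cos θ) * Real.sin θ ^ 2) -
      (1 / Real.pi) * ∫ θ in -Real.pi..Real.pi, f (torus θ) * Real.sin θ ^ 2| ≤ 2 * ε / 3 := by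
    rw [← mul_sub, abs_mul, abs_of_pos (by positivity)]
    calc _ ≤ (1 / Real.pi) * (ε / 3 * (2 * Real.pi)) := by gcongr
      _ = _ := by field_simp
  rw [abs_le] at h1 h3 ⊢
  constructor <;> linarith [h1.1, h1.2, h3.1, h3.2]

theorem fourierSum_eq {f : SU2 → ℝ} (hf : Continuous f) (hcl : ∀ x y, f (x * y) = f (y * x))
    (N : ℕ) (x : SU2) : fourierSum N (fun y => (f y : ℂ)) x =
    ((∑ n ∈ Finset.range (N + 1), ((1 / Real.pi) * ∫ θ in -Real.pi..Real.pi,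
      f (torus θ) * (Real.sin ((n + 1) * θ) * Real.sin θ)) * (U ℝ n).eval (halfTrace x) : ℝ) : ℂ) := by
  have hfC : Continuous fun y => (f y : ℂ) := Complex.continuous_ofReal.comp hf
  have hclC : ∀ x y, (f (x * y) : ℂ) = f (y * x) := fun x y => by rw [hcl]
  have h : fourierSum N (fun y => (f y : ℂ)) x =
      ∑ n ∈ Finset.range (N + 1), ((n : ℂ) + 1) * conv (fun y => (f y : ℂ)) (character n) x := by
    simp only [fourierSum, conv, dirichletKernel, Finset.mul_sum]
    rw [integral_finsetSum]
    · refine Finset.sum_congr rfl fun n _ => ?_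
      rw [← integral_const_mul]
      exact integral_congr_ae (ae_of_all _ fun y => by ring)
    · intro n _
      have := continuous_character n
      exact integrable_of_continuous (by fun_prop)
  rw [h, Complex.ofReal_sum]
  refine Finset.sum_congr rfl fun n _ => ?_
  rw [Complex.ofReal_mul, conv_character hfC hclC, character_eq]
  congr 1
  simp only [character_eq]
  have hU : Continuous fun y => (U ℝ n).eval (halfTrace y) :=
    (U ℝ n).continuous.comp continuous_halfTrace
  have hUcl : ∀ x y, (U ℝ n).eval (halfTrace (x * y)) = (U ℝ n).eval (halfTrace (y * x)) := by
    intro x y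
    have := character_mul_comm n x y
    rw [character_eq, character_eq] at this
    exact_mod_cast this
  have hw := weyl_integral (f := fun y => f y * (U ℝ n).eval (halfTrace y)) (hf.mul hU)
    fun x y => by rw [hcl, hUcl]
  have e : ∫ y, (f y : ℂ) * ((U ℝ n).eval (halfTrace y) : ℝ) ∂haar =
      ((∫ y, f y * (U ℝ n).eval (halfTrace y) ∂haar : ℝ) : ℂ) := by
    rw [← integral_complex_ofReal]; simp
  rw [e, hw]
  congr 2
  refine intervalIntegral.integral_congr fun θ _ => ?_
  have := U_real_cos θ n
  rw [Int.cast_natCast] at this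
  simp only [← this, halfTrace_torus]; ring

end SU2

/-! ### A Cesàro argument for the endpoint terms -/

/-- If the series `∑ w n` converges and `n * w n + (n + 1) * w (n + 1)` has a limit, then that
limit vanishes. -/
theorem eq_zero_of_tendsto_mul_add_mul {w : ℕ → ℝ} {S L : ℝ}
    (hS : Tendsto (fun N => ∑ n ∈ Finset.range N, w n) atTop (𝓝 S))
    (hL : Tendsto (fun n : ℕ => n * w n + (n + 1) * w (n + 1)) atTop (𝓝 L)) : L = 0 := by
  set s : ℕ → ℝ := fun N => ∑ n ∈ Finset.range N, w n with hs
  have hw : Tendsto w atTop (𝓝 0) := by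
    have := (hS.comp (tendsto_add_atTop_nat 1)).sub hS
    rw [sub_self] at this
    refine this.congr fun N => ?_
    simp [hs, Finset.sum_range_succ]
  -- Summation by parts: divided by `N`, the right side tends to `S - S = 0`.
  have h1 : ∀ N : ℕ, ∑ n ∈ Finset.range N, (n : ℝ) * w n =
      N * s N - ∑ n ∈ Finset.range N, s (n + 1) := by
    intro N
    induction N with
    | zero => simp
    | succ N ih =>
      have : s (N + 1) = s N + w N := by simp [hs, Finset.sum_range_succ]
      rw [Finset.sum_range_succ, Finset.sum_range_succ, ih, this]
      push_cast
      ring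
  have h2 : ∀ N : ℕ, ∑ n ∈ Finset.range N, ((n : ℝ) * w n + (n + 1) * w (n + 1)) =
      2 * ∑ n ∈ Finset.range N, (n : ℝ) * w n + N * w N := by
    intro N
    induction N with
    | zero => simp
    | succ N ih =>
      rw [Finset.sum_range_succ, Finset.sum_range_succ, ih]
      push_cast
      ring
  have hces := hL.cesaro
  have hces' := (hS.comp (tendsto_add_atTop_nat 1)).cesaro
  have hlim : Tendsto (fun N : ℕ => 2 * (s N - (N : ℝ)⁻¹ * ∑ n ∈ Finset.range N, s (n + 1)) + w N)
      atTop (𝓝 (2 * (S - S) + 0)) := ((hS.sub hces').const_mul 2).add hw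
  -- The Cesàro means of the sequence converging to `L` are computed a second way from `h1` and
  -- `h2`.
  have : L = 2 * (S - S) + 0 := by
    refine tendsto_nhds_unique (hces.congr' ?_) hlim
    filter_upwards [eventually_gt_atTop 0] with N hN
    have hN' : (N : ℝ) ≠ 0 := by exact_mod_cast hN.ne'
    rw [h2, h1]
    field_simp
  simpa using this

/-! ### Comparison with the cosine series and control of the boundary term -/

namespace SU2

open Polynomial.Chebyshev

/-- The index is shifted so that the induction starts at `U_{-1} = 0`; each step of `U_n = X U_{n-1}
+ T_n` adds at most `1` on `[-1, 1]`. -/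
theorem abs_eval_U_sub_one_le (n : ℕ) {t : ℝ} (ht : t ∈ Set.Icc (-1 : ℝ) 1) :
    |(U ℝ ((n : ℤ) - 1)).eval t| ≤ n := by
  induction n with
  | zero => simp
  | succ n ih =>
    have hT : |(T ℝ n).eval t| ≤ 1 := by
      rw [← Real.cos_arccos ht.1 ht.2, T_real_cos]
      exact Real.abs_cos_le_one _
    have h := congrArg (Polynomial.eval t) (U_eq_X_mul_U_add_T ℝ ((n : ℤ) - 1))
    simp only [Polynomial.eval_add, Polynomial.eval_mul, Polynomial.eval_X, sub_add_cancel] at h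
    push_cast
    rw [add_sub_cancel_right, h]
    have ht' : |t| ≤ 1 := abs_le.mpr ht
    calc _ ≤ |t * (U ℝ ((n : ℤ) - 1)).eval t| + |(T ℝ n).eval t| := abs_add_le _ _
      _ = |t| * |(U ℝ ((n : ℤ) - 1)).eval t| + |(T ℝ n).eval t| := by rw [abs_mul]
      _ ≤ 1 * n + 1 := by gcongr
      _ = _ := by ring

theorem eval_U_sub_one_neg_one (n : ℕ) : (U ℝ ((n : ℤ) - 1)).eval (-1) = -((-1) ^ n * n) := by
  induction n with
  | zero => simp
  | succ n ih =>
    have hT : (T ℝ n).eval (-1) = (-1) ^ n := by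
      rw [← Real.cos_pi, T_real_cos, Real.cos_pi, Int.cast_natCast, Real.cos_nat_mul_pi]
    have h := congrArg (Polynomial.eval (-1)) (U_eq_X_mul_U_add_T ℝ ((n : ℤ) - 1))
    simp only [Polynomial.eval_add, Polynomial.eval_mul, Polynomial.eval_X, sub_add_cancel] at h
    push_cast
    rw [add_sub_cancel_right, h, ih, hT, pow_succ]
    ring

/-- Summation by parts through `2 T_n = U_n - U_{n-2}`. The last two terms are what the telescoping
leaves over, and they decide convergence. -/
theorem sum_mul_eval_U (a : ℕ → ℝ) (N : ℕ) (t : ℝ) :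
    ∑ n ∈ Finset.range (N + 1), (a n - a (n + 2)) / 2 * (U ℝ n).eval t =
      a 0 / 2 + ∑ n ∈ Finset.range N, a (n + 1) * (T ℝ (n + 1 : ℕ)).eval t -
        (a (N + 1) * (U ℝ ((N : ℤ) - 1)).eval t + a (N + 2) * (U ℝ N).eval t) / 2 := by
  induction N with
  | zero => simp; ring
  | succ N ih =>
    rw [Finset.sum_range_succ, ih, Finset.sum_range_succ]
    have h := congrArg (Polynomial.eval t) (two_mul_T_eq_U_sub_U ℝ ((N : ℤ) - 1))
    rw [show (N : ℤ) - 1 + 2 = (N + 1 : ℕ) by push_cast; ring] at h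
    simp only [Polynomial.eval_sub, Polynomial.eval_mul, Polynomial.eval_ofNat] at h
    rw [show ((N + 1 : ℕ) : ℤ) - 1 = N by push_cast; ring]
    linear_combination (-(a (N + 1)) / 2) * h

theorem integral_mul_sin_mul_sin {F : ℝ → ℝ} (hF : Continuous F) (n : ℕ) :
    (1 / Real.pi) * ∫ θ in -Real.pi..Real.pi, F θ * (Real.sin ((n + 1) * θ) * Real.sin θ) =
      (cosCoeff F n - cosCoeff F (n + 2)) / 2 := by
  rw [cosCoeff, cosCoeff, ← mul_sub, ← intervalIntegral.integral_sub
    (Continuous.intervalIntegrable (by fun_prop) _ _)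
    (Continuous.intervalIntegrable (by fun_prop) _ _), mul_div_assoc,
    ← intervalIntegral.integral_div]
  congr 1
  refine intervalIntegral.integral_congr fun θ _ => ?_
  push_cast
  rw [show (n : ℝ) * θ = (n + 1) * θ - θ by ring, show ((n : ℝ) + 2) * θ = (n + 1) * θ + θ by ring,
    Real.cos_sub, Real.cos_add]
  ring

theorem fourierSum_eq_cosPartialSum_sub {f : SU2 → ℝ} (hf : Continuous f)
    (hcl : ∀ x y, f (x * y) = f (y * x)) (N : ℕ) (x : SU2) :
    fourierSum N (fun y => (f y : ℂ)) x =
      ((cosPartialSum (fun θ => f (torus θ)) N (Real.arccos (halfTrace x)) -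
        (cosCoeff (fun θ => f (torus θ)) (N + 1) * (U ℝ ((N : ℤ) - 1)).eval (halfTrace x) +
          cosCoeff (fun θ => f (torus θ)) (N + 2) * (U ℝ N).eval (halfTrace x)) / 2 : ℝ) : ℂ) := by
  have hF : Continuous fun θ => f (torus θ) := hf.comp continuous_torus
  simp only [fourierSum_eq hf hcl, fun n : ℕ => integral_mul_sin_mul_sin hF n]
  rw [sum_mul_eval_U, cosPartialSum]
  congr 3
  refine Finset.sum_congr rfl fun n _ => ?_
  conv_lhs => rw [← Real.cos_arccos (halfTrace_mem_Icc x).1 (halfTrace_mem_Icc x).2]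
  rw [T_real_cos, Int.cast_natCast]

theorem eq_torus_arccos_cos {f : SU2 → ℝ} (hcl : ∀ x y, f (x * y) = f (y * x)) (θ : ℝ) :
    f (torus θ) = f (torus (Real.arccos (Real.cos θ))) := by
  rw [eq_torus_of_mul_comm hcl, halfTrace_torus]

theorem tendstoUniformlyOn_cosPartialSum_torus {α : ℝ} (hα : 0 < α) {f : SU2 → ℝ}
    (hf : IsHolder α f) (hcl : ∀ x y, f (x * y) = f (y * x)) :
    TendstoUniformlyOn (cosPartialSum fun θ => f (torus θ)) (fun θ => f (torus θ)) atTop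
      (Set.Icc 0 Real.pi) := by
  obtain ⟨M, hM, hMf⟩ := id hf
  refine tendstoUniformlyOn_cosPartialSum hM hα ?_ ?_ ((hf.continuous hα).comp continuous_torus) ?_
  · intro θ
    simp only
    rw [eq_torus_arccos_cos hcl, Real.cos_add_two_pi, ← eq_torus_arccos_cos hcl]
  · intro θ
    rw [eq_torus_arccos_cos hcl, Real.cos_neg, ← eq_torus_arccos_cos hcl]
  · intro s t
    refine (hMf _ _).trans (mul_le_mul_of_nonneg_left ?_ hM)
    exact Real.rpow_le_rpow (Real.sqrt_nonneg _) (distance_torus_le s t) hα.le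

theorem tendstoUniformlyOn_fourierSum {α : ℝ} (hα : 0 < α) {f : SU2 → ℝ}
    (hf : IsHolder α f) (hcl : ∀ x y, f (x * y) = f (y * x)) {A : Set SU2} {e : ℕ → ℝ}
    (he : Tendsto e atTop (𝓝 0))
    (hA : ∀ N : ℕ, ∀ x ∈ A,
      |cosCoeff (fun θ => f (torus θ)) (N + 1) * (U ℝ ((N : ℤ) - 1)).eval (halfTrace x) +
        cosCoeff (fun θ => f (torus θ)) (N + 2) * (U ℝ N).eval (halfTrace x)| ≤ e N) :
    TendstoUniformlyOn (fun (N : ℕ) (x : SU2) => fourierSum N (fun y => (f y : ℂ)) x)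
      (fun x => (f x : ℂ)) atTop A := by
  have hu := tendstoUniformlyOn_cosPartialSum_torus hα hf hcl
  rw [Metric.tendstoUniformlyOn_iff] at hu ⊢
  intro ε hε
  filter_upwards [hu (ε / 2) (half_pos hε), he.eventually_lt_const hε] with N h1 h2 x hx
  have h1' := h1 (Real.arccos (halfTrace x)) ⟨Real.arccos_nonneg _, Real.arccos_le_pi _⟩
  have h3 := (hA N x hx).trans_lt h2
  rw [fourierSum_eq_cosPartialSum_sub (hf.continuous hα) hcl, Complex.dist_of_im_eq (by rw [Complex.ofReal_im, Complex.ofReal_im]),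
    Complex.ofReal_re, Complex.ofReal_re, eq_torus_of_mul_comm hcl x]
  rw [Real.dist_eq] at h1' ⊢
  rw [abs_lt] at *
  constructor <;> linarith [h1'.1, h1'.2, h3.1, h3.2]

/-- At `θ = 0` every cosine is `1`, so the coefficients are differences of consecutive terms of a
convergent sequence. -/
theorem tendsto_cosCoeff_torus {α : ℝ} (hα : 0 < α) {f : SU2 → ℝ}
    (hf : IsHolder α f) (hcl : ∀ x y, f (x * y) = f (y * x)) :
    Tendsto (cosCoeff fun θ => f (torus θ)) atTop (𝓝 0) := by
  have h := (tendstoUniformlyOn_cosPartialSum_torus hα hf hcl).tendsto_at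
    (Set.left_mem_Icc.mpr Real.pi_pos.le)
  have h' := (h.comp (tendsto_add_atTop_nat 1)).sub h
  rw [sub_self] at h'
  rw [← tendsto_add_atTop_iff_nat 1]
  refine h'.congr fun N => ?_
  simp [cosPartialSum, Finset.sum_range_succ]

theorem eq_one_or_eq_negOne {x : SU2} (hx : halfTrace x ^ 2 = 1) : x = 1 ∨ x = negOne := by
  obtain ⟨g, hg⟩ := exists_conj_torus x
  rcases sq_eq_sq_iff_eq_or_eq_neg.mp (hx.trans (one_pow 2).symm) with h | h
  · left
    rw [h, Real.arccos_one, torus_zero] at hg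
    simpa using hg
  · right
    rw [h, Real.arccos_neg_one, torus_pi] at hg
    have hcomm : g * negOne = negOne * g := Subtype.ext (by simp [negOne])
    rw [hg, hcomm, mul_assoc, mul_inv_cancel, mul_one]

theorem abs_eval_U_mul_le (n : ℤ) {t : ℝ} (ht : t ∈ Set.Icc (-1 : ℝ) 1) :
    |(U ℝ n).eval t| * Real.sqrt (1 - t ^ 2) ≤ 1 := by
  have h := U_real_cos (Real.arccos t) n
  rw [Real.cos_arccos ht.1 ht.2, Real.sin_arccos] at h
  rw [← abs_of_nonneg (Real.sqrt_nonneg (1 - t ^ 2)), ← abs_mul, h]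
  exact Real.abs_sin_le_one _

/-- Convergence away from `±e`. -/
theorem tendstoUniformlyOn_fourierSum_compl {α : ℝ} (hα : 0 < α) {f : SU2 → ℝ}
    (hf : IsHolder α f) (hcl : ∀ x y, f (x * y) = f (y * x)) {V : Set SU2} (hV : IsOpen V)
    (h1 : 1 ∈ V) (h2 : negOne ∈ V) :
    TendstoUniformlyOn (fun (N : ℕ) (x : SU2) => fourierSum N (fun y => (f y : ℂ)) x)
      (fun x => (f x : ℂ)) atTop Vᶜ := by
  have hcont : Continuous fun x => Real.sqrt (1 - halfTrace x ^ 2) :=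
    Real.continuous_sqrt.comp (continuous_const.sub (continuous_halfTrace.pow 2))
  -- The function `√(1 - halfTrace²)`, which is `sin θ`, vanishes only at `±e`; on the compact
  -- complement of `V` it has a positive lower bound.
  obtain ⟨δ, hδ, hmin⟩ := hV.isClosed_compl.isCompact.exists_forall_le' hcont.continuousOn
    (a := 0) fun x hx => by
      refine Real.sqrt_pos.mpr (sub_pos.mpr (lt_of_le_of_ne ?_ fun h => ?_))
      · rw [sq_le_one_iff_abs_le_one]
        exact abs_le.mpr (halfTrace_mem_Icc x)
      · rcases eq_one_or_eq_negOne h with rfl | rfl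
        · exact hx h1
        · exact hx h2
  have hU : ∀ (n : ℤ), ∀ x ∈ Vᶜ, |(U ℝ n).eval (halfTrace x)| ≤ δ⁻¹ := by
    intro n x hx
    have ha := abs_eval_U_mul_le n (halfTrace_mem_Icc x)
    rw [← one_div, le_div_iff₀ hδ]
    exact (mul_le_mul_of_nonneg_left (hmin x hx) (abs_nonneg _)).trans ha
  set a := cosCoeff fun θ => f (torus θ) with ha
  have h0 := (tendsto_cosCoeff_torus hα hf hcl).abs
  have he : Tendsto (fun N => |a (N + 1)| * δ⁻¹ + |a (N + 2)| * δ⁻¹) atTop (𝓝 0) := by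
    have := ((h0.comp (tendsto_add_atTop_nat 1)).mul_const δ⁻¹).add
      ((h0.comp (tendsto_add_atTop_nat 2)).mul_const δ⁻¹)
    simpa using this
  refine tendstoUniformlyOn_fourierSum hα hf hcl he fun N x hx => (abs_add_le _ _).trans ?_
  rw [abs_mul, abs_mul]
  gcongr
  · exact hU _ x hx
  · exact hU _ x hx

/-- If the Fourier sums converge at `±e`, then `n * a n → 0` for the cosine coefficients `a n` of
the restriction to the torus. -/
theorem tendsto_nat_mul_cosCoeff_torus {α : ℝ} (hα : 0 < α) {f : SU2 → ℝ}
    (hf : IsHolder α f) (hcl : ∀ x y, f (x * y) = f (y * x))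
    (h1 : ∃ l : ℂ, Tendsto (fun N : ℕ => fourierSum N (fun y => (f y : ℂ)) 1) atTop (𝓝 l))
    (h2 : ∃ l : ℂ, Tendsto (fun N : ℕ => fourierSum N (fun y => (f y : ℂ)) negOne) atTop (𝓝 l)) :
    Tendsto (fun N : ℕ => N * cosCoeff (fun θ => f (torus θ)) (N + 1)) atTop (𝓝 0) := by
  have hfc := hf.continuous hα
  set a := cosCoeff fun θ => f (torus θ) with ha
  have hunif := tendstoUniformlyOn_cosPartialSum_torus hα hf hcl
  have hs0 := hunif.tendsto_at (Set.left_mem_Icc.mpr Real.pi_pos.le)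
  have hsπ := hunif.tendsto_at (Set.right_mem_Icc.mpr Real.pi_pos.le)
  obtain ⟨l, hl⟩ := h1
  obtain ⟨l', hl'⟩ := h2
  have htone : halfTrace 1 = 1 := by rw [← torus_zero, halfTrace_torus, Real.cos_zero]
  have htneg : halfTrace negOne = -1 := by rw [← torus_pi, halfTrace_torus, Real.cos_pi]
  -- With `U_{N-1}(1) = N`, this is twice the boundary term at `e`, the difference of two convergent
  -- sequences.
  have hL : Tendsto (fun N : ℕ => N * a (N + 1) + (N + 1) * a (N + 1 + 1)) atTop
      (𝓝 (2 * (f (torus 0) - l.re))) := by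
    refine ((hs0.sub ((Complex.continuous_re.tendsto _).comp hl)).const_mul 2).congr fun N => ?_
    simp only [Function.comp_apply, fourierSum_eq_cosPartialSum_sub hfc hcl, Complex.ofReal_re,
      htone, Real.arccos_one, U_eval_one]
    push_cast
    ring
  -- At `-e` the same holds for the alternating coefficients `(-1)^N a (N+1)`, since `U_{N-1}(-1) =
  -- -(-1)^N N`.
  have hL' : Tendsto (fun N : ℕ => N * ((-1) ^ N * a (N + 1)) +
      (N + 1) * ((-1) ^ (N + 1) * a (N + 1 + 1))) atTop
      (𝓝 (-2 * (f (torus Real.pi) - l'.re))) := by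
    refine ((hsπ.sub ((Complex.continuous_re.tendsto _).comp hl')).const_mul (-2)).congr
      fun N => ?_
    have hN := eval_U_sub_one_neg_one (N + 1)
    rw [Nat.cast_add_one, add_sub_cancel_right] at hN
    simp only [Function.comp_apply, fourierSum_eq_cosPartialSum_sub hfc hcl, Complex.ofReal_re,
      htneg, Real.arccos_neg_one, eval_U_sub_one_neg_one, hN]
    push_cast
    ring
  have hS : Tendsto (fun N => ∑ n ∈ Finset.range N, a (n + 1)) atTop
      (𝓝 (f (torus 0) - a 0 / 2)) := by
    refine (hs0.sub_const (a 0 / 2)).congr fun N => ?_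
    simp [cosPartialSum, ha]
  have hS' : Tendsto (fun N => ∑ n ∈ Finset.range N, (-1) ^ n * a (n + 1)) atTop
      (𝓝 (-(f (torus Real.pi) - a 0 / 2))) := by
    refine (hsπ.sub_const (a 0 / 2)).neg.congr fun N => ?_
    rw [cosPartialSum, ← ha, add_sub_cancel_left, ← Finset.sum_neg_distrib]
    refine Finset.sum_congr rfl fun n _ => ?_
    rw [Real.cos_nat_mul_pi, pow_succ]
    ring
  rw [eq_zero_of_tendsto_mul_add_mul hS hL] at hL
  rw [eq_zero_of_tendsto_mul_add_mul hS' hL'] at hL'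
  rw [← tendsto_add_atTop_iff_nat 1]
  have hsum := (hL.abs.add hL'.abs).div_const 2
  simp only [abs_zero, add_zero, zero_div] at hsum
  refine squeeze_zero_norm (fun N => ?_) hsum
  -- Up to sign the alternating expression is the difference of the two terms whose sum appears in
  -- `hL`; sum minus difference leaves `2 (N+1) a (N+2)`.
  have habs : |(N : ℝ) * ((-1) ^ N * a (N + 1)) + (N + 1) * ((-1) ^ (N + 1) * a (N + 1 + 1))| =
      |(N : ℝ) * a (N + 1) - (N + 1) * a (N + 1 + 1)| := by
    rw [show (N : ℝ) * ((-1) ^ N * a (N + 1)) + (N + 1) * ((-1) ^ (N + 1) * a (N + 1 + 1)) =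
      (-1) ^ N * (N * a (N + 1) - (N + 1) * a (N + 1 + 1)) by rw [pow_succ]; ring, abs_mul]
    simp
  rw [habs, Real.norm_eq_abs, Nat.cast_add_one, le_div_iff₀ two_pos]
  have := abs_sub (N * a (N + 1) + (N + 1) * a (N + 1 + 1))
    (N * a (N + 1) - (N + 1) * a (N + 1 + 1))
  rw [show N * a (N + 1) + (N + 1) * a (N + 1 + 1) -
    (N * a (N + 1) - (N + 1) * a (N + 1 + 1)) = ((N + 1) * a (N + 1 + 1)) * 2 by ring, abs_mul,
    abs_two] at this
  exact this

end SU2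

theorem mainTheorem2 (α : ℝ) (hα0 : 0 < α) (hα1 : α < 1) (f : SU2 → ℝ)
    (hf : SU2.IsHolder α f) (hc : SU2.IsCentral fun x => (f x : ℂ)) :
    (∀ U : Set SU2, IsOpen U → 1 ∈ U → SU2.negOne ∈ U →
      TendstoUniformlyOn (fun (N : ℕ) (x : SU2) => SU2.fourierSum N (fun y => (f y : ℂ)) x)
        (fun x => (f x : ℂ)) atTop Uᶜ) ∧
    ((∃ l : ℂ, Tendsto (fun N : ℕ => SU2.fourierSum N (fun y => (f y : ℂ)) 1) atTop (𝓝 l)) →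
      (∃ l : ℂ, Tendsto (fun N : ℕ => SU2.fourierSum N (fun y => (f y : ℂ)) SU2.negOne)
        atTop (𝓝 l)) →
      TendstoUniformly (fun (N : ℕ) (x : SU2) => SU2.fourierSum N (fun y => (f y : ℂ)) x)
        (fun x => (f x : ℂ)) atTop) := by
  have hcl := SU2.mul_comm_of_isCentral (hf.continuous hα0) hc
  refine ⟨fun V hV h1 h2 => SU2.tendstoUniformlyOn_fourierSum_compl hα0 hf hcl hV h1 h2,
    fun h1 h2 => ?_⟩
  rw [← tendstoUniformlyOn_univ]
  have h0 := (SU2.tendsto_nat_mul_cosCoeff_torus hα0 hf hcl h1 h2).abs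
  have he := h0.add (h0.comp (tendsto_add_atTop_nat 1))
  rw [abs_zero, add_zero] at he
  refine SU2.tendstoUniformlyOn_fourierSum hα0 hf hcl he fun N x _ => (abs_add_le _ _).trans ?_
  -- The growth bounds `N` and `N + 1` of the two Chebyshev factors are exactly the weights
  -- appearing in `he`.
  have hN := SU2.abs_eval_U_sub_one_le N (SU2.halfTrace_mem_Icc x)
  have hN1 := SU2.abs_eval_U_sub_one_le (N + 1) (SU2.halfTrace_mem_Icc x)
  rw [Nat.cast_add_one, add_sub_cancel_right] at hN1
  simp only [Function.comp_apply, abs_mul, Nat.abs_cast]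
  rw [mul_comm (N : ℝ), mul_comm ((N + 1 : ℕ) : ℝ)]
  gcongr
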